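/- Let $n\ge 1$ and let $W$ be the affine Weyl group of type $\tilde A_n$, i.e. the Coxeter group with simple reflections $s_0,s_1,\dots,s_n$ whose Coxeter graph is the cycle $0,1,\dots,n$ (all edges with $m_{st}=3$) for $n\ge2$, and with $m_{s_0s_1}=\infty$ for $n=1$. A realization of $W$ over a commutative ring $R$ is a free $R$-module $\mathfrak h$ of finite rank with elements $\alpha_i^\vee\in\mathfrak h$ and $\alpha_i\in\mathfrak h^*=\mathrm{Hom}_R(\mathfrak h,R)$ $(0\le i\le n)$ such that $\langle\alpha_i^\vee,\alpha_i\rangle=2$ for all $i$ and such that $s_i(v)=v-\langle v,\alpha_i\rangle\alpha_i^\vee$ defines a representation of $W$ on $\mathfrak h$. It has Cartan matrix $a_{ij}=\langle\alpha_i^\vee,\alpha_j\rangle$. An exotic realization is a realization over $\mathbb Z[q,q^{-1}]$ with the following Cartan matrix: $a_{ii}=2$; for $n=1$, $a_{01}=a_{10}=-(q+q^{-1})$; for $n\ge2$, $a_{01}=a_{n0}=-q$, $a_{10}=a_{0n}=-q^{-1}$, $a_{ij}=-1$ for $i,j\ge1$ with $|i-j|=1$, and all other entries are $0$. Let $\mathfrak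 h$ be an exotic realization, let $\Bbbk$ be a nonzero commutative ring without $2$-torsion, equipped with a ring homomorphism $\mathbb Z[q,q^{-1}]\to\Bbbk$, and write $q$ also for the image of $q$ in $\Bbbk$. Let $t=s_1s_2\cdots s_{n-1}s_ns_{n-1}\cdots s_2s_1$ be the reflection in the highest root $\alpha_1+\dots+\alpha_n$. Consider the representation of $W$ on the base change $\Bbbk\otimes_{\mathbb Z[q,q^{-1}]}\mathfrak h$. 1. If $q^2\in\Bbbk$ is not a root of unity, then this representation is faithful. 2. Suppose that $q^2$ is a primitive $m$-th root of unity (an element of exact multiplicative order $m\geq 1$) and that $q^2-1$ is not a zero divisor in $\Bbbk$ (when $\Bbbk$ is a domain, this says $m\ge2$, i.e. $q\ne\pm1$). Then the representation is not faithful, and its kernel is exactly the normal subgroup of $W$ generated by $(s_0t)^m$. -/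

import Mathlib

open scoped LaurentPolynomial TensorProduct

/-- The Coxeter matrix of affine type `Ã_n` (`n ≥ 1`): the nodes `0, 1, …, n` form a cycle, with `0`
the affine node. Mathlib's convention is that the entry `0` stands for `m_{st} = ∞`. -/
def affineA (n : ℕ) : CoxeterMatrix (Fin (n + 1)) where
  M := Matrix.of fun i j =>
    if i = j then 1
    else if n = 1 then 0
    else if j = i + 1 ∨ i = j + 1 then 3
    else 2
  isSymm := by
    ext i j
    simp only [Matrix.transpose_apply, Matrix.of_apply, eq_comm (a := j) (b := i),
      or_comm (a := i = j + 1)]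
  diagonal i := by simp
  off_diagonal i j h := by
    simp only [Matrix.of_apply, if_neg h]
    split_ifs <;> decide

section Realization

variable {B W : Type*} [Group W] {M : CoxeterMatrix B}

/-- A (simple) realization of a Coxeter system `(W, S)` over a commutative ring `k`: a free
`k`-module `h` of finite rank with simple coroots in `h` and simple roots in `h* = Hom(h, k)`, such
that `⟨α_s^∨, α_s⟩ = 2` and such that `s(v) = v - ⟨v, α_s⟩ α_s^∨` defines a representation of `W`
on `h` (which is then uniquely determined, since the simple reflections generate `W`). -/
structure Realization (cs : CoxeterSystem M W) (k h : Type*) [CommRing k] [AddCommGroup h]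
    [Module k h] [Module.Free k h] [Module.Finite k h] where
  /-- the simple coroots -/
  coroot : B → h
  /-- the simple roots -/
  root : B → Module.Dual k h
  root_coroot_self : ∀ s, root s (coroot s) = 2
  /-- the representation of `W` on `h` -/
  rep : Representation k W h
  rep_simple : ∀ s v, rep (cs.simple s) v = v - root s v • coroot s

namespace Realization

variable {cs : CoxeterSystem M W} {k h : Type*} [CommRing k] [AddCommGroup h]
    [Module k h] [Module.Free k h] [Module.Finite k h]

/-- The Cartan matrix `a_{s,t} = ⟨α_s^∨, α_t⟩` of a realization. -/
def cartanMatrix (X : Realization cs k h) : Matrix B B k :=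
  Matrix.of fun s t => X.root t (X.coroot s)

/-- The base change of a realization along `k → k'`. -/
noncomputable def baseChange (X : Realization cs k h) (k' : Type*) [CommRing k'] [Algebra k k'] :
    Realization cs k' (k' ⊗[k] h) where
  coroot s := 1 ⊗ₜ[k] X.coroot s
  root s := (X.root s).baseChange k'
  root_coroot_self s := by
    rw [Module.Dual.baseChange_apply_tmul, X.root_coroot_self, two_smul, one_add_one_eq_two]
  rep :=
    { toFun := fun w => (X.rep w).baseChange k'
      map_one' := by rw [map_one, LinearMap.baseChange_one]
      map_mul' := fun x y => by rw [map_mul, LinearMap.baseChange_mul] }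
  rep_simple s v := by
    change (X.rep (cs.simple s)).baseChange k' v = _
    induction v with
    | zero => simp
    | add x y hx hy => rw [map_add, hx, hy, map_add, add_smul]; abel
    | tmul a x =>
      rw [LinearMap.baseChange_tmul, X.rep_simple, Module.Dual.baseChange_apply_tmul,
        TensorProduct.tmul_sub, TensorProduct.tmul_smul, smul_assoc, TensorProduct.smul_tmul',
        TensorProduct.smul_tmul', TensorProduct.smul_tmul', smul_eq_mul, mul_one]

end Realization

end Realization

/-- The exotic affine Cartan matrix of `sl_{n+1}` (`n ≥ 1`) with parameter `q` and inverse
parameter `q'`; the index `0` is the affine node. For `n ≥ 2`, the entries in row and column `0` are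
`a_{0,1} = a_{n,0} = -q` and `a_{1,0} = a_{0,n} = -q⁻¹`. -/
def exoticCartanMatrix {k : Type*} [CommRing k] (n : ℕ) (q q' : k) :
    Matrix (Fin (n + 1)) (Fin (n + 1)) k :=
  Matrix.of fun i j =>
    if i = j then 2
    else if n = 1 then -(q + q')
    else if (i = 0 ∧ j = 1) ∨ (i = Fin.last n ∧ j = 0) then -q
    else if (i = 1 ∧ j = 0) ∨ (i = 0 ∧ j = Fin.last n) then -q'
    else if (i : ℕ) + 1 = j ∨ (j : ℕ) + 1 = i then -1
    else 0

/-- An exotic realization of the affine Weyl group of type `Ã_n`: a realization over `ℤ[q, q⁻¹]`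
whose Cartan matrix is the exotic one. Here `q` is the variable `T 1`. -/
def Realization.IsExotic {n : ℕ} {W : Type*} [Group W] {cs : CoxeterSystem (affineA n) W}
    {h : Type*} [AddCommGroup h] [Module ℤ[T;T⁻¹] h] [Module.Free ℤ[T;T⁻¹] h]
    [Module.Finite ℤ[T;T⁻¹] h] (X : Realization cs ℤ[T;T⁻¹] h) : Prop :=
  X.cartanMatrix = exoticCartanMatrix n (LaurentPolynomial.T 1) (LaurentPolynomial.T (-1))

/-- The reflection `t = s_1 s_2 ⋯ s_{n-1} s_n s_{n-1} ⋯ s_2 s_1` in the highest root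
`α_1 + ⋯ + α_n` of the finite Weyl group `⟨s_1, …, s_n⟩`. -/
def highestReflection {n : ℕ} {W : Type*} [Group W] (cs : CoxeterSystem (affineA n) W) : W :=
  cs.wordProd ((List.finRange n).map Fin.succ ++ ((List.finRange n).map Fin.succ).reverse.tail)

/-! `W` acts on `ℤ` by affine permutations: `s_i` exchanges `z` and `z + 1` whenever `z ≡ i` modulo
`n + 1`. This action is faithful (`affineAction_injective`). An exotic realization contains vectors
`ε_z` (`exoticVector`) with `w ε_z = ε_{w z}` and `ε_{z + (n+1)a} = q^{2a} ε_z`, and `ε_z - ε_{z+1}`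
is a unit times `1 - q²` times a simple coroot. So a translation multiplies each `ε_z` by a power of
`q²`, and the order of `q²` governs the kernel.

Suppose `q² - 1` is regular. A combination of roots detects the class of `0` among the `ε_z`, with
regular value `(1 - q²)(1 - q⁻²)`. Hence a kernel element moves every `z` by some `(n+1)a` with
`q^{2a} = 1`. Conversely such a `w` fixes all `ε_z`, hence all coroots, and by duality all roots;
then `w v - v` lies in the coroot span and is killed by every root, so it vanishes
(`rep_eq_one_iff`). Since `s₀t` shifts class `1` up and class `0` down by one period, conjugates of
`(s₀t)^m` suffice to clear the classes one by one (`mem_normalClosure_of_affineAction`).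

Suppose `q²` is not a root of unity. Now `q² - 1` may be a zero divisor, so the argument runs over
`ℤ[q, q⁻¹]`, with `K` the kernel of the map to `k`. If `w` acts trivially over `k` and `w 0 =
(n+1)l` with `l ≥ 0`, then `ε_0` has eigenvalue `q^{2l}`, and `w - 1` has entries in `K`. Applying
it twice puts `(q^{2l} - 1)²(q² - 1)` in `K²`. Over the principal ideal domain `ℚ[X]`,
squarefreeness of `X² - 1` then removes that factor, which membership of `(q^{2l} - 1)(q² - 1)` in
`K` alone would not permit. Thus `q^{2l} - 1` is torsion in `k`; it also has square zero, so
`q^{2lM} = 1` for some `M > 0`, forcing `l = 0`. The kernel therefore contains no nontrivial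
translation. Commutators of its elements with `s₀t` are translations in the kernel, so its elements
commute with `s₀t`; this makes them preserve every class, and they are trivial. -/

/-! ### Affine permutations of `ℤ`. -/

/-- The class of an integer among the nodes `0, …, n` of the cyclic diagram. -/
def cyclicNode (n : ℕ) (z : ℤ) : Fin (n + 1) := (z : ZMod (n + 1))

theorem cyclicNode_add_one (n : ℕ) (z : ℤ) : cyclicNode n (z + 1) = cyclicNode n z + 1 :=
  (show ((z + 1 : ℤ) : ZMod (n + 1)) = (z : ZMod (n + 1)) + 1 by push_cast; rfl)

theorem cyclicNode_sub_one (n : ℕ) (z : ℤ) : cyclicNode n (z - 1) = cyclicNode n z - 1 := by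
  rw [eq_sub_iff_add_eq, ← cyclicNode_add_one, sub_add_cancel]

theorem cyclicNode_eq_iff {n : ℕ} {y z : ℤ} :
    cyclicNode n y = cyclicNode n z ↔ ∃ a : ℤ, y = z + (n + 1) * a := by
  refine (ZMod.intCast_eq_intCast_iff_dvd_sub y z (n + 1)).trans ⟨?_, ?_⟩
  · rintro ⟨a, ha⟩
    refine ⟨-a, ?_⟩
    push_cast at ha
    linarith
  · rintro ⟨a, rfl⟩
    exact ⟨-a, by push_cast; ring⟩

theorem cyclicNode_val (n : ℕ) (z : ℤ) : ((cyclicNode n z : ℕ) : ℤ) = z % (n + 1) := by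
  have := ZMod.val_intCast (n := n + 1) z
  push_cast at this
  exact this

theorem cyclicNode_natCast_val {n : ℕ} (i : Fin (n + 1)) : cyclicNode n ((i : ℕ) : ℤ) = i := by
  apply Fin.ext
  have h := cyclicNode_val n (i : ℕ)
  rw [Int.emod_eq_of_lt (by positivity) (by have := i.2; omega)] at h
  exact_mod_cast h

theorem cyclicNode_add_mul (n : ℕ) (z a : ℤ) :
    cyclicNode n (z + (n + 1) * a) = cyclicNode n z := cyclicNode_eq_iff.2 ⟨a, rfl⟩

theorem Fin.add_one_ne_self {n : ℕ} (hn : 1 ≤ n) (i : Fin (n + 1)) : i + 1 ≠ i := by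
  intro h
  rw [add_eq_left, Fin.ext_iff, Fin.val_one', Nat.mod_eq_of_lt (by omega)] at h
  simp at h

theorem Fin.add_one_add_one_ne_self {n : ℕ} (hn : 2 ≤ n) (i : Fin (n + 1)) : i + 1 + 1 ≠ i := by
  intro h
  rw [add_assoc, add_eq_left, Fin.ext_iff, Fin.val_add, Fin.val_one',
    Nat.mod_eq_of_lt (a := 1) (by omega), Nat.mod_eq_of_lt (by omega)] at h
  simp at h

/-- The function on `ℤ` exchanging `z` and `z + 1` for all `z` in the class of the node `i`. -/
def affineSwapFun (n : ℕ) (i : Fin (n + 1)) (z : ℤ) : ℤ :=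
  if cyclicNode n z = i then z + 1 else if cyclicNode n z = i + 1 then z - 1 else z

theorem affineSwapFun_involutive {n : ℕ} (hn : 1 ≤ n) (i : Fin (n + 1)) :
    Function.Involutive (affineSwapFun n i) := by
  intro z
  have h1 := Fin.add_one_ne_self hn i
  by_cases h : cyclicNode n z = i
  · simp [affineSwapFun, h, cyclicNode_add_one, h1]
  by_cases h' : cyclicNode n z = i + 1
  · simp [affineSwapFun, h', cyclicNode_sub_one, h1]
  · simp [affineSwapFun, h, h']

/-- The simple affine permutation of `ℤ` attached to the node `i`. -/
def affineSwap {n : ℕ} (hn : 1 ≤ n) (i : Fin (n + 1)) : Equiv.Perm ℤ :=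
  (affineSwapFun_involutive hn i).toPerm

section AffineSwap

variable {n : ℕ} (hn : 1 ≤ n) {i : Fin (n + 1)} {z : ℤ}

theorem affineSwap_apply_left (h : cyclicNode n z = i) : affineSwap hn i z = z + 1 := by
  simp [affineSwap, affineSwapFun, h]

theorem affineSwap_apply_right (h : cyclicNode n z = i + 1) : affineSwap hn i z = z - 1 := by
  simp [affineSwap, affineSwapFun, h, Fin.add_one_ne_self hn i]

theorem affineSwap_apply_of_ne (h : cyclicNode n z ≠ i) (h' : cyclicNode n z ≠ i + 1) :
    affineSwap hn i z = z := by
  simp [affineSwap, affineSwapFun, h, h']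

theorem affineSwap_affineSwap (i : Fin (n + 1)) (z : ℤ) :
    affineSwap hn i (affineSwap hn i z) = z := affineSwapFun_involutive hn i z

theorem affineSwap_mul_self (i : Fin (n + 1)) : affineSwap hn i * affineSwap hn i = 1 :=
  Equiv.ext fun z => affineSwap_affineSwap hn i z

theorem affineSwap_add_mul (i : Fin (n + 1)) (z a : ℤ) :
    affineSwap hn i (z + (n + 1) * a) = affineSwap hn i z + (n + 1) * a := by
  simp only [affineSwap, Function.Involutive.coe_toPerm, affineSwapFun, cyclicNode_add_mul]
  split_ifs <;> ring

theorem affineSwap_braid (h2 : 2 ≤ n) (i : Fin (n + 1)) :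
    affineSwap hn i * affineSwap hn (i + 1) * affineSwap hn i =
      affineSwap hn (i + 1) * affineSwap hn i * affineSwap hn (i + 1) := by
  have e1 := Fin.add_one_ne_self hn i
  have e2 := Fin.add_one_ne_self hn (i + 1)
  have e3 := Fin.add_one_add_one_ne_self h2 i
  ext z
  simp only [affineSwap, Equiv.Perm.mul_apply, Function.Involutive.coe_toPerm]
  by_cases h : cyclicNode n z = i
  · simp [affineSwapFun, h, cyclicNode_add_one, e1.symm, e2, e3, e3.symm]
  by_cases h' : cyclicNode n z = i + 1
  · simp [affineSwapFun, h', cyclicNode_add_one, cyclicNode_sub_one, e1, e1.symm, e2, e3,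
      e3.symm]
  by_cases h'' : cyclicNode n z = i + 1 + 1
  · simp [affineSwapFun, h'', cyclicNode_sub_one, e1, e1.symm, e2, e3, e3.symm]
  · simp [affineSwapFun, h, h', h'']

theorem affineSwap_comm {i j : Fin (n + 1)} (hij : i ≠ j) (h : j ≠ i + 1) (h' : i ≠ j + 1) :
    affineSwap hn i * affineSwap hn j = affineSwap hn j * affineSwap hn i := by
  have e1 := Fin.add_one_ne_self hn i
  have e2 := Fin.add_one_ne_self hn j
  have e3 : i + 1 ≠ j + 1 := fun h => hij (add_right_cancel h)
  ext z
  simp only [affineSwap, Equiv.Perm.mul_apply, Function.Involutive.coe_toPerm]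
  by_cases h1 : cyclicNode n z = i
  · simp [affineSwapFun, h1, cyclicNode_add_one, hij, h', e3, h.symm]
  by_cases h2 : cyclicNode n z = i + 1
  · simp [affineSwapFun, h2, cyclicNode_sub_one, hij, h', e3, h.symm, e1]
  by_cases h3 : cyclicNode n z = j
  · simp [affineSwapFun, h3, cyclicNode_add_one, hij.symm, h, e3.symm, h'.symm]
  by_cases h4 : cyclicNode n z = j + 1
  · simp [affineSwapFun, h4, cyclicNode_sub_one, hij.symm, h, e3.symm, h'.symm, e2]
  · simp [affineSwapFun, h1, h2, h3, h4]

end AffineSwap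

/-! ### The action of `W` on `ℤ` and its faithfulness. -/

theorem affineA_apply {n : ℕ} (i j : Fin (n + 1)) : affineA n i j =
    if i = j then 1 else if n = 1 then 0 else if j = i + 1 ∨ i = j + 1 then 3 else 2 := rfl

theorem pow_three_eq_one_of_braid {G : Type*} [Group G] {a b : G} (ha : a * a = 1)
    (hb : b * b = 1) (h : a * b * a = b * a * b) : (a * b) ^ 3 = 1 := by
  calc (a * b) ^ 3 = a * b * a * (b * a * b) := by simp only [pow_succ, pow_zero, one_mul, mul_assoc]
    _ = a * b * (a * a) * b * a := by rw [← h]; simp only [mul_assoc]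
    _ = 1 := by rw [ha, mul_one, mul_assoc a b b, hb, mul_one, ha]

theorem affineSwap_isLiftable {n : ℕ} (hn : 1 ≤ n) : (affineA n).IsLiftable (affineSwap hn) := by
  intro i j
  have hsq := affineSwap_mul_self hn
  rw [affineA_apply]
  split_ifs with h1 h2 h3
  · rw [h1, pow_one, hsq]
  · exact pow_zero _
  · rcases h3 with rfl | rfl
    · exact pow_three_eq_one_of_braid (hsq _) (hsq _) (affineSwap_braid hn (by omega) i)
    · exact pow_three_eq_one_of_braid (hsq _) (hsq _) (affineSwap_braid hn (by omega) j).symm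
  · push Not at h3
    rw [pow_two, mul_assoc, ← mul_assoc (affineSwap hn j), ← affineSwap_comm hn h1 h3.1 h3.2,
      mul_assoc (affineSwap hn i), hsq, mul_one, hsq]

section AffineAction

variable {n : ℕ} (hn : 1 ≤ n) {W : Type*} [Group W] (cs : CoxeterSystem (affineA n) W)

/-- The action of the affine Weyl group of type `Ã_n` on `ℤ` by affine permutations. -/
def affineAction : W →* Equiv.Perm ℤ := cs.lift ⟨affineSwap hn, affineSwap_isLiftable hn⟩

theorem affineAction_simple (i : Fin (n + 1)) :
    affineAction hn cs (cs.simple i) = affineSwap hn i :=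
  cs.lift_apply_simple (affineSwap_isLiftable hn) i

theorem affineAction_mul_apply (v w : W) (z : ℤ) :
    affineAction hn cs (v * w) z = affineAction hn cs v (affineAction hn cs w z) := by
  rw [map_mul, Equiv.Perm.mul_apply]

theorem affineAction_add_mul (w : W) (z a : ℤ) :
    affineAction hn cs w (z + (n + 1) * a) = affineAction hn cs w z + (n + 1) * a := by
  induction w using cs.simple_induction_left with
  | one => simp
  | mul_simple_left w i ih =>
    rw [affineAction_mul_apply, ih, affineAction_simple, affineSwap_add_mul,
      ← affineAction_simple hn cs, ← affineAction_mul_apply]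

theorem affineAction_inv_apply (w : W) (z : ℤ) :
    affineAction hn cs w⁻¹ (affineAction hn cs w z) = z := by
  rw [← affineAction_mul_apply, inv_mul_cancel, map_one, Equiv.Perm.one_apply]

theorem affineAction_apply_inv (w : W) (z : ℤ) :
    affineAction hn cs w (affineAction hn cs w⁻¹ z) = z := by
  rw [← affineAction_mul_apply, mul_inv_cancel, map_one, Equiv.Perm.one_apply]

/-- Right descents are visible as inversions of adjacent integers. Induction on length: strip a
right descent `j` of `w` and work inside the rank-two subgroup generated by `s_i` and `s_j`. -/
theorem affineAction_lt_of_not_isRightDescent (w : W) (i : Fin (n + 1))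
    (hw : ¬ cs.IsRightDescent w i) (z : ℤ) (hz : cyclicNode n z = i) :
    affineAction hn cs w z < affineAction hn cs w (z + 1) := by
  induction hl : cs.length w using Nat.strong_induction_on generalizing w i z with
  | _ l ih =>
  subst hl
  rcases eq_or_ne w 1 with rfl | hw1
  · simp
  obtain ⟨j, hj⟩ := cs.exists_rightDescent_of_ne_one hw1
  have hij : i ≠ j := fun h => hw (h ▸ hj)
  obtain ⟨v, rfl⟩ : ∃ v, w = v * cs.simple j :=
    ⟨w * cs.simple j, (cs.simple_mul_simple_cancel_right j).symm⟩
  rw [cs.isRightDescent_iff, cs.simple_mul_simple_cancel_right] at hj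
  have hvj : ¬ cs.IsRightDescent v j := by
    rw [cs.not_isRightDescent_iff]; exact hj.symm
  have hwi : cs.length (v * cs.simple j * cs.simple i) = cs.length (v * cs.simple j) + 1 :=
    cs.not_isRightDescent_iff.1 hw
  have ihv := fun i h z hz => ih (cs.length v) (by omega) v i h z hz rfl
  simp only [affineAction_mul_apply, affineAction_simple]
  have e1 := Fin.add_one_ne_self hn
  -- Here `m_{ij} = ∞` and no relation is available, but `s_j` spreads `z, z + 1` to `z - 1, z + 2`,
  -- and `v (z + 2) = v z + 2`.
  by_cases h1 : n = 1
  · subst h1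
    have hne : ∀ i j : Fin (1 + 1), i ≠ j → j = i + 1 := by decide
    have hji := hne i j hij
    have hij' := hne j i hij.symm
    have hz1 : cyclicNode 1 (z + 1) = j := by rw [cyclicNode_add_one, hz, hji]
    rw [affineSwap_apply_right hn (hz.trans hij'), affineSwap_apply_left hn hz1]
    have h3 := ihv j hvj (z - 1) (by rw [cyclicNode_sub_one, hz, hij', add_sub_cancel_right])
    have h4 := affineAction_add_mul hn cs v z 1
    rw [show z + ((1 : ℕ) + 1) * 1 = z + 1 + 1 by push_cast; ring] at h4
    rw [h4]
    rw [sub_add_cancel] at h3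
    push_cast
    linarith
  have h2 : 2 ≤ n := by omega
  by_cases h3 : j = i + 1 ∨ i = j + 1
  · have hbraid : cs.simple i * cs.simple j * cs.simple i =
        cs.simple j * cs.simple i * cs.simple j := by
      have h := cs.simple_mul_simple_pow i j
      rw [affineA_apply, if_neg hij, if_neg h1, if_pos h3, pow_succ, pow_two] at h
      rw [← mul_inv_eq_one, mul_inv_rev, mul_inv_rev]
      simp only [cs.inv_simple]
      simpa only [mul_assoc] using h
    -- If `j` were a descent of `v s_i` as well, the braid relation would bound the length of `v s_j
    -- s_i` by that of `v`, whereas it exceeds it by two.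
    have hu : cs.IsRightDescent v i →
        ∃ u, v = u * cs.simple i ∧ cs.length u < cs.length v ∧ ¬ cs.IsRightDescent u j := by
      intro hi
      refine ⟨v * cs.simple i, (cs.simple_mul_simple_cancel_right i).symm, hi, fun hd => ?_⟩
      rw [cs.isRightDescent_iff] at hi hd
      have h4 : v * cs.simple j * cs.simple i =
          v * cs.simple i * cs.simple j * cs.simple i * cs.simple j := by
        have : v * cs.simple j * cs.simple i =
            v * cs.simple i * (cs.simple i * cs.simple j * cs.simple i) := by
          simp only [← mul_assoc, cs.simple_mul_simple_cancel_right]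
        rw [this, hbraid]
        simp only [mul_assoc]
      have h5 := cs.length_mul_le (v * cs.simple i * cs.simple j) (cs.simple i * cs.simple j)
      have h6 := cs.length_mul_le (cs.simple i) (cs.simple j)
      rw [← mul_assoc, ← h4] at h5
      simp only [cs.length_simple] at h6
      omega
    have e2 := Fin.add_one_add_one_ne_self h2
    rcases h3 with rfl | rfl
    · have hz1 : cyclicNode n (z + 1) = i + 1 := by rw [cyclicNode_add_one, hz]
      have hz2 : cyclicNode n (z + 1 + 1) = i + 1 + 1 := by rw [cyclicNode_add_one, hz1]
      rw [affineSwap_apply_of_ne hn (hz ▸ hij) (by rw [hz]; exact (e2 i).symm),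
        affineSwap_apply_left hn hz1]
      by_cases hd : cs.IsRightDescent v i
      · obtain ⟨u, rfl, hul, huj⟩ := hu hd
        simp only [affineAction_mul_apply, affineAction_simple]
        rw [affineSwap_apply_left hn hz,
          affineSwap_apply_of_ne hn (by rw [hz2]; exact e2 i) (by rw [hz2]; exact e1 _)]
        exact ih _ (by omega) u _ huj _ hz1 rfl
      · exact (ihv i hd z hz).trans (ihv _ hvj _ hz1)
    · have hz1 : cyclicNode n (z + 1) = j + 1 + 1 := by rw [cyclicNode_add_one, hz]
      have hz2 : cyclicNode n (z - 1) = j := by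
        rw [cyclicNode_sub_one, hz, add_sub_cancel_right]
      rw [affineSwap_apply_right hn hz,
        affineSwap_apply_of_ne hn (by rw [hz1]; exact e2 j) (by rw [hz1]; exact e1 _)]
      by_cases hd : cs.IsRightDescent v (j + 1)
      · obtain ⟨u, rfl, hul, huj⟩ := hu hd
        simp only [affineAction_mul_apply, affineAction_simple]
        rw [affineSwap_apply_right hn hz1,
          affineSwap_apply_of_ne hn (by rw [hz2]; exact hij.symm)
            (by rw [hz2]; exact (e2 j).symm)]
        have := ih _ (by omega) u _ huj _ hz2 rfl
        rw [sub_add_cancel] at this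
        rwa [add_sub_cancel_right]
      · have := ihv j hvj _ hz2
        rw [sub_add_cancel] at this
        exact this.trans (ihv _ hd _ hz)
  · push Not at h3
    have e3 : i + 1 ≠ j + 1 := fun h => hij (add_right_cancel h)
    have hz1 : cyclicNode n (z + 1) = i + 1 := by rw [cyclicNode_add_one, hz]
    rw [affineSwap_apply_of_ne hn (hz ▸ hij) (hz ▸ h3.2),
      affineSwap_apply_of_ne hn (hz1 ▸ h3.1.symm) (hz1 ▸ e3)]
    -- The reflections commute, so a descent `i` of `v` would make `w s_i` too short.
    refine ihv i (fun hd => ?_) z hz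
    have hcomm : cs.simple i * cs.simple j = cs.simple j * cs.simple i := by
      have h := cs.simple_mul_simple_pow i j
      rw [affineA_apply, if_neg hij, if_neg h1, if_neg (by tauto), pow_two] at h
      rw [← mul_inv_eq_one, mul_inv_rev]
      simpa only [cs.inv_simple, mul_assoc] using h
    rw [mul_assoc, ← hcomm, ← mul_assoc] at hwi
    have h5 := cs.length_mul_le (v * cs.simple i) (cs.simple j)
    rw [cs.length_simple] at h5
    rw [cs.isRightDescent_iff] at hd
    omega

/-- A nontrivial `w` has a right descent `i`, and then `w` reverses the order of the neighbours `i`,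
`i + 1`. -/
theorem affineAction_injective : Function.Injective (affineAction hn cs) := by
  rw [injective_iff_map_eq_one]
  intro w hw
  by_contra hne
  obtain ⟨i, hi⟩ := cs.exists_rightDescent_of_ne_one hne
  have h := affineAction_lt_of_not_isRightDescent hn cs _ i
    (cs.isRightDescent_iff_not_isRightDescent_mul.1 hi) _ (cyclicNode_natCast_val i)
  simp only [affineAction_mul_apply, hw, Equiv.Perm.one_apply, affineAction_simple] at h
  rw [affineSwap_apply_left hn (cyclicNode_natCast_val i), affineSwap_apply_right hn
    (by rw [cyclicNode_add_one, cyclicNode_natCast_val])] at h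
  omega

theorem eq_one_of_affineAction {w : W} (h : ∀ z, affineAction hn cs w z = z) : w = 1 :=
  affineAction_injective hn cs (by rw [map_one]; exact Equiv.ext h)

end AffineAction

/-! ### Vectors of an exotic realization permuted by `W`. -/

/-- The factor by which the simple coroot of node `i` is rescaled. -/
def nodeScale {k : Type*} [CommRing k] {n : ℕ} (Q : kˣ) (i : Fin (n + 1)) : kˣ :=
  if i = 0 then Q⁻¹ else 1

/-- Diagonal rescaling pushes the parameter into the two corner entries, as `q²` and `q⁻²`. For `n =
1` the corners coincide with the neighbour entries and add to them, so one formula serves all `n ≥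
1`. -/
theorem nodeScale_mul_exoticCartanMatrix {k : Type*} [CommRing k] {n : ℕ} (hn : 1 ≤ n) (Q : kˣ)
    (i j : Fin (n + 1)) :
    (nodeScale Q i : k) * exoticCartanMatrix n (Q : k) (↑Q⁻¹ : k) i j =
      nodeScale Q j * ((if (i : ℕ) = j then 2 else 0) - (if (i : ℕ) + 1 = j then 1 else 0) -
        (if (i : ℕ) = j + 1 then 1 else 0) -
        (if (i : ℕ) = n then (if (j : ℕ) = 0 then ((Q ^ 2 : kˣ) : k) else 0) else 0) -
        (if (i : ℕ) = 0 then (if (j : ℕ) = n then ((Q⁻¹ ^ 2 : kˣ) : k) else 0) else 0)) := by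
  have hQ : (Q : k) * (↑Q⁻¹ : k) = 1 := Q.mul_inv
  have h1 : ((1 : Fin (n + 1)) : ℕ) = 1 := by rw [Fin.val_one', Nat.mod_eq_of_lt (by omega)]
  have hi := i.2
  have hj := j.2
  simp only [nodeScale, exoticCartanMatrix, Matrix.of_apply, Fin.ext_iff, h1, Fin.val_last,
    Fin.val_zero, Units.val_pow_eq_pow_val]
  rw [apply_ite Units.val, apply_ite Units.val, Units.val_one]
  generalize (i : ℕ) = a at *
  generalize (j : ℕ) = b at *
  generalize (Q : k) = u at *
  generalize (↑Q⁻¹ : k) = v at *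
  clear h1 i j
  grind

/-- The step row, `x` before `r` and `1` afterwards, is annihilated by the rescaled matrix except at
the jump and its cyclic predecessor; the corner entries absorb the mismatch at the seam. -/
theorem sum_range_step_mul {k : Type*} [CommRing k] {n r j : ℕ} (hn : 1 ≤ n) (hr : r ≤ n)
    (hj : j ≤ n) (x y : k) (hxy : x * y = 1) :
    ∑ i ∈ Finset.range (n + 1), (if i < r then x else 1) *
      ((if i = j then 2 else 0) - (if i + 1 = j then 1 else 0) - (if i = j + 1 then 1 else 0) -
        (if i = n then (if j = 0 then x else 0) else 0) -
        (if i = 0 then (if j = n then y else 0) else 0)) =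
      if j = r then 1 - x else if j + 1 = r then -(1 - x)
        else if j = n ∧ r = 0 then -(y * (1 - x)) else 0 := by
  have h : ∀ i, (if i + 1 = j then (1 : k) else 0) =
      if i = j - 1 then (if j = 0 then 0 else 1) else 0 := by
    intro i; grind
  simp only [h, mul_sub, Finset.sum_sub_distrib, mul_ite, mul_zero, Finset.sum_ite_eq',
    Finset.mem_range]
  grind

section ExoticVectors

variable {n : ℕ} {W : Type*} [Group W] {cs : CoxeterSystem (affineA n) W}
  {k : Type*} [CommRing k] {h : Type*} [AddCommGroup h] [Module k h] [Module.Free k h]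
  [Module.Finite k h]

namespace Realization

/-- The linear combination of simple coroots from which `exoticVector` is built. -/
def exoticBase (X : Realization cs k h) (Q : kˣ) (r : Fin (n + 1)) : h :=
  ∑ i : Fin (n + 1), ((if (i : ℕ) < r then ((Q ^ 2 : kˣ) : k) else 1) * nodeScale Q i) • X.coroot i

/-- A family of vectors of an exotic realization, indexed by `ℤ`, that `W` permutes through its
action on `ℤ` and that is quasi-periodic with multiplier `q²`. -/
def exoticVector (X : Realization cs k h) (Q : kˣ) (z : ℤ) : h :=
  (((Q ^ 2) ^ (z / (n + 1)) : kˣ) : k) • X.exoticBase Q (cyclicNode n z)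

/-- A combination of the simple roots that vanishes on `exoticVector z` unless `z` lies in the
class of the node `0`. -/
def exoticFunctional (X : Realization cs k h) (Q : kˣ) : Module.Dual k h :=
  ∑ j : Fin (n + 1), ((nodeScale Q j)⁻¹ : kˣ).val • X.root j

variable (X : Realization cs k h) (Q : kˣ)

theorem root_exoticBase (hn : 1 ≤ n)
    (hX : X.cartanMatrix = exoticCartanMatrix n (Q : k) (↑Q⁻¹ : k)) (j r : Fin (n + 1)) :
    X.root j (X.exoticBase Q r) = nodeScale Q j *
      (if (j : ℕ) = r then 1 - ((Q ^ 2 : kˣ) : k) else if (j : ℕ) + 1 = r then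
        -(1 - ((Q ^ 2 : kˣ) : k)) else if (j : ℕ) = n ∧ (r : ℕ) = 0 then
        -(((Q⁻¹ ^ 2 : kˣ) : k) * (1 - ((Q ^ 2 : kˣ) : k))) else 0) := by
  have ha : ∀ i, X.root j (X.coroot i) = exoticCartanMatrix n (Q : k) (↑Q⁻¹ : k) i j := by
    intro i; rw [← hX]; rfl
  rw [← sum_range_step_mul hn (Nat.lt_succ_iff.1 r.2) (Nat.lt_succ_iff.1 j.2) ((Q ^ 2 : kˣ) : k)
    ((Q⁻¹ ^ 2 : kˣ) : k) (by rw [← Units.val_mul, ← mul_pow, mul_inv_cancel, one_pow, Units.val_one]),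
    exoticBase, map_sum, Finset.mul_sum, ← Fin.sum_univ_eq_sum_range (fun i => (nodeScale Q j : k) * _)]
  refine Finset.sum_congr rfl fun i _ => ?_
  rw [map_smul, smul_eq_mul, ha, mul_assoc, nodeScale_mul_exoticCartanMatrix hn]
  ring

theorem exoticVector_add_mul (z a : ℤ) :
    X.exoticVector Q (z + (n + 1) * a) = (((Q ^ 2) ^ a : kˣ) : k) • X.exoticVector Q z := by
  rw [exoticVector, exoticVector, cyclicNode_add_mul, smul_smul, ← Units.val_mul, ← zpow_add,
    Int.add_mul_ediv_left _ _ (by positivity), add_comm]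

theorem exoticVector_natCast (r : Fin (n + 1)) :
    X.exoticVector Q ((r : ℕ) : ℤ) = X.exoticBase Q r := by
  rw [exoticVector, cyclicNode_natCast_val, Int.ediv_eq_zero_of_lt (by positivity)
    (by have := r.2; omega), zpow_zero, Units.val_one, one_smul]

theorem exists_eq_natCast_add_mul (z : ℤ) :
    ∃ (r : Fin (n + 1)) (a : ℤ), z = ((r : ℕ) : ℤ) + (n + 1) * a :=
  ⟨cyclicNode n z, z / (n + 1), by rw [cyclicNode_val, Int.emod_add_mul_ediv]⟩

/-- Moving the jump from `r` to `r + 1` changes only the coefficient at node `r`, from `1` to `q²`.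
At `r = n` the next vector is `q²` times the one at `0`, which has the same shape. -/
theorem exoticBase_sub_exoticVector (r : Fin (n + 1)) :
    X.exoticBase Q r - X.exoticVector Q (((r : ℕ) : ℤ) + 1) =
      ((1 - ((Q ^ 2 : kˣ) : k)) * nodeScale Q r) • X.coroot r := by
  have key : X.exoticVector Q (((r : ℕ) : ℤ) + 1) =
      ∑ i : Fin (n + 1), ((if (i : ℕ) < r + 1 then ((Q ^ 2 : kˣ) : k) else 1) * nodeScale Q i) •
        X.coroot i := by
    rcases (Nat.lt_succ_iff.1 r.2).lt_or_eq with hr | hr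
    · exact X.exoticVector_natCast Q ⟨r + 1, by omega⟩
    · have := X.exoticVector_add_mul Q ((0 : Fin (n + 1)) : ℕ) 1
      rw [exoticVector_natCast, Fin.val_zero, Nat.cast_zero, zero_add, mul_one] at this
      rw [hr, this, exoticBase, Finset.smul_sum]
      refine Finset.sum_congr rfl fun i _ => ?_
      rw [if_pos i.2, smul_smul, Fin.val_zero, if_neg (Nat.not_lt_zero _), one_mul, zpow_one]
  rw [key, exoticBase, ← Finset.sum_sub_distrib, Finset.sum_eq_single r]
  · rw [if_neg (lt_irrefl _), if_pos (Nat.lt_succ_self _), ← sub_smul]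
    ring_nf
  · intro i _ hi
    have hi : (i : ℕ) ≠ r := fun h => hi (Fin.ext h)
    rw [sub_eq_zero]
    congr 3
    exact propext ⟨fun h => by omega, fun h => by omega⟩
  · simp

theorem exoticVector_sub_exoticVector_add_one (z : ℤ) :
    X.exoticVector Q z - X.exoticVector Q (z + 1) =
      ((((Q ^ 2) ^ (z / (n + 1)) : kˣ) : k) * ((1 - ((Q ^ 2 : kˣ) : k)) *
        nodeScale Q (cyclicNode n z))) • X.coroot (cyclicNode n z) := by
  obtain ⟨r, a, rfl⟩ := exists_eq_natCast_add_mul (n := n) z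
  rw [add_right_comm, exoticVector_add_mul, exoticVector_add_mul, ← smul_sub, exoticVector_natCast,
    exoticBase_sub_exoticVector, smul_smul, cyclicNode_add_mul, cyclicNode_natCast_val,
    Int.add_mul_ediv_left _ _ (by positivity), Int.ediv_eq_zero_of_lt (by positivity)
    (by have := r.2; omega), zero_add]

/-- The root of the node of `z` takes on `ε_z` exactly the coefficient in `ε_z - ε_{z+1}`, so the
reflection moves `ε_z` to `ε_{z+1}`. The reverse move follows as `s_i` is an involution, and in the
remaining classes the root vanishes. -/
theorem rep_simple_exoticVector (hn : 1 ≤ n)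
    (hX : X.cartanMatrix = exoticCartanMatrix n (Q : k) (↑Q⁻¹ : k)) (i : Fin (n + 1)) (z : ℤ) :
    X.rep (cs.simple i) (X.exoticVector Q z) = X.exoticVector Q (affineSwap hn i z) := by
  have h0 : ∀ z, cyclicNode n z = i →
      X.rep (cs.simple i) (X.exoticVector Q z) = X.exoticVector Q (z + 1) := by
    rintro z rfl
    rw [X.rep_simple, sub_eq_iff_eq_add', ← sub_eq_iff_eq_add,
      exoticVector_sub_exoticVector_add_one, exoticVector, map_smul, root_exoticBase _ _ hn hX,
      if_pos rfl, smul_eq_mul, mul_comm (nodeScale Q _ : k)]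
  by_cases h1 : cyclicNode n z = i
  · rw [affineSwap_apply_left hn h1, h0 z h1]
  by_cases h2 : cyclicNode n z = i + 1
  · have h3 : cyclicNode n (z - 1) = i := by rw [cyclicNode_sub_one, h2, add_sub_cancel_right]
    have h4 := h0 _ h3
    rw [sub_add_cancel] at h4
    rw [affineSwap_apply_right hn h2, ← h4, ← Module.End.mul_apply, ← map_mul,
      cs.simple_mul_simple_self, map_one, Module.End.one_apply]
  · rw [affineSwap_apply_of_ne hn h1 h2, X.rep_simple, exoticVector, map_smul,
      root_exoticBase _ _ hn hX, if_neg, if_neg, if_neg, mul_zero, smul_zero, zero_smul, sub_zero]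
    · rintro ⟨h3, h4⟩
      refine h2 (Fin.ext ?_)
      rw [h4, Fin.val_add_one, if_pos (Fin.ext h3)]
    · intro h3
      refine h2 (Fin.ext ?_)
      rw [Fin.val_add_one, if_neg, h3]
      rintro rfl
      have := (cyclicNode n z).2
      rw [Fin.val_last] at h3
      omega
    · exact fun h3 => h1 (Fin.ext h3.symm)

theorem rep_exoticVector (hn : 1 ≤ n)
    (hX : X.cartanMatrix = exoticCartanMatrix n (Q : k) (↑Q⁻¹ : k)) (w : W) (z : ℤ) :
    X.rep w (X.exoticVector Q z) = X.exoticVector Q (affineAction hn cs w z) := by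
  induction w using cs.simple_induction_left with
  | one => simp
  | mul_simple_left w i ih =>
    rw [map_mul, Module.End.mul_apply, ih, X.rep_simple_exoticVector Q hn hX,
      affineAction_mul_apply, affineAction_simple]

/-- For `r ≠ 0` the values at the jump and its predecessor cancel. For `r = 0` the predecessor is
across the seam and carries `q⁻²`, leaving `(1 - q²)(1 - q⁻²)`. -/
theorem exoticFunctional_exoticBase (hn : 1 ≤ n)
    (hX : X.cartanMatrix = exoticCartanMatrix n (Q : k) (↑Q⁻¹ : k)) (r : Fin (n + 1)) :
    X.exoticFunctional Q (X.exoticBase Q r) =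
      if r = 0 then (1 - ((Q ^ 2 : kˣ) : k)) * (1 - ((Q⁻¹ ^ 2 : kˣ) : k)) else 0 := by
  simp only [exoticFunctional, LinearMap.sum_apply, LinearMap.smul_apply, smul_eq_mul,
    X.root_exoticBase Q hn hX, Units.inv_mul_cancel_left]
  rw [Fin.sum_univ_eq_sum_range (fun j => if j = (r : ℕ) then 1 - ((Q ^ 2 : kˣ) : k) else
    if j + 1 = r then -(1 - ((Q ^ 2 : kˣ) : k)) else if j = n ∧ (r : ℕ) = 0 then
        -(((Q⁻¹ ^ 2 : kˣ) : k) * (1 - ((Q ^ 2 : kˣ) : k))) else 0)]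
  have hr := r.2
  simp only [Fin.ext_iff, Fin.val_zero]
  generalize (r : ℕ) = r at *
  have h : ∀ j, (if j = r then 1 - ((Q ^ 2 : kˣ) : k) else
    if j + 1 = r then -(1 - ((Q ^ 2 : kˣ) : k)) else if j = n ∧ r = 0 then
        -(((Q⁻¹ ^ 2 : kˣ) : k) * (1 - ((Q ^ 2 : kˣ) : k))) else 0) =
      (if j = r then 1 - ((Q ^ 2 : kˣ) : k) else 0) +
      (if j = r - 1 then (if r = 0 then 0 else -(1 - ((Q ^ 2 : kˣ) : k))) else 0) +
      (if j = n then (if r = 0 then -(((Q⁻¹ ^ 2 : kˣ) : k) * (1 - ((Q ^ 2 : kˣ) : k))) else 0)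
        else 0) := by
    intro j; grind
  simp only [h, Finset.sum_add_distrib, Finset.sum_ite_eq', Finset.mem_range]
  grind

theorem exoticFunctional_exoticVector (hn : 1 ≤ n)
    (hX : X.cartanMatrix = exoticCartanMatrix n (Q : k) (↑Q⁻¹ : k)) (z : ℤ) :
    X.exoticFunctional Q (X.exoticVector Q z) =
      if cyclicNode n z = 0 then (((Q ^ 2) ^ (z / (n + 1)) : kˣ) : k) *
        ((1 - ((Q ^ 2 : kˣ) : k)) * (1 - ((Q⁻¹ ^ 2 : kˣ) : k))) else 0 := by
  rw [exoticVector, map_smul, exoticFunctional_exoticBase _ _ hn hX, smul_eq_mul, mul_ite, mul_zero]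

end Realization

end ExoticVectors

/-! ### Translations and the conjugates of `s₀t`. -/

section AffineTranslations

variable {n : ℕ} (hn : 1 ≤ n) {W : Type*} [Group W] (cs : CoxeterSystem (affineA n) W)

theorem exists_affineAction_eq (y z : ℤ) : ∃ w : W, affineAction hn cs w y = z := by
  have h : ∀ z : ℤ, ∃ w : W, affineAction hn cs w 0 = z := by
    intro z
    induction z using Int.induction_on with
    | zero => exact ⟨1, by simp⟩
    | succ i ih =>
      obtain ⟨w, hw⟩ := ih
      exact ⟨cs.simple (cyclicNode n i) * w, by
        rw [affineAction_mul_apply, hw, affineAction_simple, affineSwap_apply_left hn rfl]⟩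
    | pred i ih =>
      obtain ⟨w, hw⟩ := ih
      exact ⟨cs.simple (cyclicNode n (-(i : ℤ) - 1)) * w, by
        rw [affineAction_mul_apply, hw, affineAction_simple, affineSwap_apply_right hn
          (by rw [← cyclicNode_add_one, sub_add_cancel])]⟩
  obtain ⟨v, rfl⟩ := h y
  obtain ⟨w, rfl⟩ := h z
  exact ⟨w * v⁻¹, by rw [affineAction_mul_apply, affineAction_inv_apply]⟩

theorem natCast_val_cyclicNode (n : ℕ) (z : ℤ) :
    ((cyclicNode n z : ℕ) : ℤ) = z + (n + 1) * (-(z / (n + 1))) := by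
  rw [cyclicNode_val, Int.emod_def]; ring

theorem cyclicNode_natCast_inj {n r s : ℕ} (hr : r ≤ n) (hs : s ≤ n)
    (h : cyclicNode n r = cyclicNode n s) : r = s := by
  have h' := congrArg (fun i : Fin (n + 1) => ((i : ℕ) : ℤ)) h
  simp only [cyclicNode_val] at h'
  rw [Int.emod_eq_of_lt (by positivity) (by omega), Int.emod_eq_of_lt (by positivity) (by omega)]
    at h'
  exact_mod_cast h'

theorem cyclicNode_affineAction_congr (w : W) {y z : ℤ} (h : cyclicNode n y = cyclicNode n z) :
    affineAction hn cs w y - y = affineAction hn cs w z - z := by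
  obtain ⟨a, rfl⟩ := cyclicNode_eq_iff.1 h
  rw [affineAction_add_mul]; ring

theorem cyclicNode_affineSwap (i : Fin (n + 1)) (z : ℤ) :
    cyclicNode n (affineSwap hn i z) = Equiv.swap i (i + 1) (cyclicNode n z) := by
  by_cases h1 : cyclicNode n z = i
  · rw [affineSwap_apply_left hn h1, cyclicNode_add_one, h1, Equiv.swap_apply_left]
  by_cases h2 : cyclicNode n z = i + 1
  · rw [affineSwap_apply_right hn h2, cyclicNode_sub_one, h2, Equiv.swap_apply_right,
      add_sub_cancel_right]
  · rw [affineSwap_apply_of_ne hn h1 h2, Equiv.swap_apply_of_ne_of_ne h1 h2]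

/-- Displacement depends only on the class. Precomposing with `s_i` permutes the classes and adds
`+1` at `i` and `-1` at `i + 1`. -/
theorem affineAction_sum_displacement (w : W) :
    ∑ r : Fin (n + 1), (affineAction hn cs w ((r : ℕ) : ℤ) - ((r : ℕ) : ℤ)) = 0 := by
  induction w using cs.simple_induction_right with
  | one => simp
  | mul_simple_right w i ih =>
    have h : ∀ r : Fin (n + 1), affineAction hn cs (w * cs.simple i) ((r : ℕ) : ℤ) - ((r : ℕ) : ℤ) =
        (affineAction hn cs w ((Equiv.swap i (i + 1) r : Fin (n + 1)) : ℕ) -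
          ((Equiv.swap i (i + 1) r : Fin (n + 1)) : ℕ)) +
        ((if r = i then 1 else 0) - (if r = i + 1 then 1 else 0)) := by
      intro r
      have hr : cyclicNode n ((Equiv.swap i (i + 1) r : Fin (n + 1)) : ℕ) =
          cyclicNode n (affineSwap hn i ((r : ℕ) : ℤ)) := by
        rw [cyclicNode_natCast_val, cyclicNode_affineSwap, cyclicNode_natCast_val]
      rw [cyclicNode_affineAction_congr hn cs w hr, affineAction_mul_apply, affineAction_simple,
        sub_add_eq_add_sub, sub_eq_sub_iff_add_eq_add]
      have h1 := Fin.add_one_ne_self hn i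
      by_cases h2 : r = i
      · rw [affineSwap_apply_left hn (h2 ▸ cyclicNode_natCast_val r), if_pos h2,
          if_neg (h2 ▸ h1.symm)]
        ring
      by_cases h3 : r = i + 1
      · rw [affineSwap_apply_right hn (h3 ▸ cyclicNode_natCast_val r), if_pos h3, if_neg h2]
        ring
      · rw [affineSwap_apply_of_ne hn (by rwa [cyclicNode_natCast_val])
          (by rwa [cyclicNode_natCast_val]), if_neg h2, if_neg h3]
        ring
    simp only [h, Finset.sum_add_distrib, Finset.sum_sub_distrib, Finset.sum_ite_eq',
      Finset.mem_univ, if_true, sub_self, add_zero]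
    rw [← Finset.sum_sub_distrib]
    exact (Equiv.sum_comp (Equiv.swap i (i + 1))
      (fun r : Fin (n + 1) => affineAction hn cs w ((r : ℕ) : ℤ) - ((r : ℕ) : ℤ))).trans ih

theorem affineAction_prod_simple (d : ℕ) (hd : d ≤ n) :
    affineAction hn cs
      ((List.range d).map fun i : ℕ => cs.simple (cyclicNode n (i + 1))).prod (d + 1) = 1 ∧
    ∀ z : ℤ, (d : ℤ) + 1 < z → z ≤ n + 1 →
      affineAction hn cs ((List.range d).map fun i : ℕ => cs.simple (cyclicNode n (i + 1))).prod z = z := by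
  induction d with
  | zero => simp
  | succ d ih =>
    obtain ⟨ih1, ih2⟩ := ih (by omega)
    have hne : ∀ y z : ℤ, y < z → z ≤ y + n → cyclicNode n z ≠ cyclicNode n y := by
      intro y z h1 h2 h
      obtain ⟨a, rfl⟩ := cyclicNode_eq_iff.1 h
      have : 0 < a := by
        by_contra ha
        nlinarith
      nlinarith
    simp only [List.range_succ, List.map_append, List.prod_append, List.map_cons, List.map_nil,
      List.prod_singleton, affineAction_mul_apply, affineAction_simple]
    refine ⟨?_, fun z hz hz' => ?_⟩
    · rw [affineSwap_apply_right hn (by push_cast; rw [cyclicNode_add_one])]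
      push_cast
      rw [add_sub_cancel_right, ih1]
    · push_cast at hz
      rw [affineSwap_apply_of_ne, ih2 z (by omega) hz']
      · exact hne _ _ (by omega) (by omega)
      · rw [← cyclicNode_add_one]
        exact hne _ _ (by omega) (by omega)

/-- With `p = s_1 ⋯ s_n`, the factor `s_n` cancels the first letter of `p⁻¹`, so `t` is a conjugate
of `s_n` and its action follows from two values of `p`. -/
theorem highestReflection_eq :
    ∃ p : W, highestReflection cs = p * cs.simple (cyclicNode n n) * p⁻¹ ∧
      affineAction hn cs p n = n + 1 ∧ affineAction hn cs p (n + 1) = 1 := by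
  obtain ⟨d, rfl⟩ : ∃ d, n = d + 1 := ⟨n - 1, by omega⟩
  have hsucc : ∀ i : Fin (d + 1), cyclicNode (d + 1) (((i : ℕ) : ℤ) + 1) = i.succ := by
    intro i
    rw [← cyclicNode_natCast_val i.succ, Fin.val_succ, Nat.cast_succ]
  have hp : cs.wordProd ((List.finRange (d + 1)).map Fin.succ) =
      ((List.range (d + 1)).map fun i : ℕ => cs.simple (cyclicNode (d + 1) (i + 1))).prod := by
    rw [CoxeterSystem.wordProd, ← List.map_coe_finRange_eq_range, List.map_map, List.map_map]
    congr 2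
    funext i
    simp only [Function.comp_apply, hsucc]
  refine ⟨_, ?_, ?_, (affineAction_prod_simple hn cs (d + 1) le_rfl).1⟩
  · have hlast : cyclicNode (d + 1) ((d + 1 : ℕ) : ℤ) = (Fin.last d).succ := by
      rw [← hsucc, Fin.val_last, Nat.cast_succ]
    have hrev : ((List.finRange (d + 1)).map Fin.succ).reverse =
        (Fin.last d).succ :: ((List.finRange (d + 1)).map Fin.succ).reverse.tail := by
      rw [List.finRange_succ_last]; simp
    have h := cs.wordProd_reverse ((List.finRange (d + 1)).map Fin.succ)
    rw [hrev, cs.wordProd_cons] at h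
    rw [← hp, highestReflection, cs.wordProd_append, ← h, hlast, mul_assoc,
      cs.simple_mul_simple_cancel_left]
  · rw [List.range_succ, List.map_append, List.prod_append, affineAction_mul_apply, List.map_singleton,
      List.prod_singleton, affineAction_simple, affineSwap_apply_left hn (by rw [Nat.cast_succ])]
    exact (affineAction_prod_simple hn cs d (by omega)).2 _ (by push_cast; omega) le_rfl

theorem affineAction_conj_simple (p : W) (i : Fin (n + 1)) {y z : ℤ} (hy : cyclicNode n y = i) :
    affineAction hn cs (p * cs.simple i * p⁻¹) z =
      if cyclicNode n z = cyclicNode n (affineAction hn cs p y) then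
        z + (affineAction hn cs p (y + 1) - affineAction hn cs p y)
      else if cyclicNode n z = cyclicNode n (affineAction hn cs p (y + 1)) then
        z - (affineAction hn cs p (y + 1) - affineAction hn cs p y)
      else z := by
  subst hy
  rw [affineAction_mul_apply, affineAction_mul_apply, affineAction_simple]
  obtain ⟨u, rfl⟩ : ∃ u, z = affineAction hn cs p u :=
    ⟨_, (affineAction_apply_inv hn cs p z).symm⟩
  rw [affineAction_inv_apply]
  have hiff : ∀ u v, cyclicNode n (affineAction hn cs p u) = cyclicNode n (affineAction hn cs p v) ↔
      cyclicNode n u = cyclicNode n v := by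
    intro u v
    simp only [cyclicNode_eq_iff, ← affineAction_add_mul, EmbeddingLike.apply_eq_iff_eq]
  simp only [hiff, cyclicNode_add_one]
  split_ifs with h1 h2
  · rw [affineSwap_apply_left hn h1]
    obtain ⟨a, rfl⟩ := cyclicNode_eq_iff.1 h1
    rw [add_right_comm, affineAction_add_mul, affineAction_add_mul]
    ring
  · rw [affineSwap_apply_right hn h2]
    rw [← cyclicNode_add_one] at h2
    obtain ⟨a, rfl⟩ := cyclicNode_eq_iff.1 h2
    rw [show y + 1 + (n + 1) * a - 1 = y + (n + 1) * a by ring, affineAction_add_mul,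
      affineAction_add_mul]
    ring
  · rw [affineSwap_apply_of_ne hn h1 h2]

/-- The action of `s₀ t` on `ℤ`. -/
theorem affineAction_simple_zero_mul_highestReflection (z : ℤ) :
    affineAction hn cs (cs.simple 0 * highestReflection cs) z =
      if cyclicNode n z = 1 then z + (n + 1) else if cyclicNode n z = 0 then z - (n + 1) else z := by
  obtain ⟨p, hp, hp1, hp2⟩ := highestReflection_eq hn cs
  have h0 : cyclicNode n 0 = 0 := cyclicNode_natCast_val (0 : Fin (n + 1))
  have h1 : cyclicNode n 1 = 1 := by rw [← zero_add (1 : ℤ), cyclicNode_add_one, h0, zero_add]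
  have hN : cyclicNode n (n + 1) = 0 := by
    rw [← h0]; exact cyclicNode_eq_iff.2 ⟨1, by ring⟩
  have h01 : (1 : Fin (n + 1)) ≠ 0 := by
    have := Fin.add_one_ne_self hn 0; rwa [zero_add] at this
  rw [affineAction_mul_apply, hp, affineAction_conj_simple hn cs p _ rfl, hp1, hp2, hN, h1,
    affineAction_simple]
  by_cases hz0 : cyclicNode n z = 0
  · rw [if_pos hz0, if_neg (hz0 ▸ h01.symm), if_pos hz0, affineSwap_apply_right,
      show z + (1 - ((n : ℤ) + 1)) - 1 = z - (n + 1) by ring]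
    · have : cyclicNode n (z + (1 - (n + 1))) = cyclicNode n (z + 1) :=
        cyclicNode_eq_iff.2 ⟨-1, by ring⟩
      rw [this, cyclicNode_add_one, hz0]
  by_cases hz1 : cyclicNode n z = 1
  · rw [if_neg hz0, if_pos hz1, if_pos hz1, affineSwap_apply_left]
    · ring
    · have : cyclicNode n (z - (1 - (n + 1))) = cyclicNode n (z - 1) :=
        cyclicNode_eq_iff.2 ⟨1, by ring⟩
      rw [this, cyclicNode_sub_one, hz1, sub_self]
  · rw [if_neg hz0, if_neg hz1, if_neg hz1, if_neg hz0,
      affineSwap_apply_of_ne hn hz0 (by rwa [zero_add])]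

/-- A power of a conjugate of `s₀ t`. -/
theorem affineAction_conj_zpow (g : W) (a z : ℤ) :
    affineAction hn cs (g * (cs.simple 0 * highestReflection cs) ^ a * g⁻¹) z =
      if cyclicNode n z = cyclicNode n (affineAction hn cs g 1) then z + (n + 1) * a
      else if cyclicNode n z = cyclicNode n (affineAction hn cs g 0) then z - (n + 1) * a else z := by
  have h0 : cyclicNode n 0 = 0 := cyclicNode_natCast_val (0 : Fin (n + 1))
  have h1 : cyclicNode n 1 = 1 := by rw [← zero_add (1 : ℤ), cyclicNode_add_one, h0, zero_add]
  have hpow : ∀ z, affineAction hn cs ((cs.simple 0 * highestReflection cs) ^ a) z =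
      if cyclicNode n z = 1 then z + (n + 1) * a
      else if cyclicNode n z = 0 then z - (n + 1) * a else z := by
    have e1 : ∀ z, cyclicNode n (z + (n + 1)) = cyclicNode n z := fun z =>
      cyclicNode_eq_iff.2 ⟨1, by ring⟩
    have e2 : ∀ z, cyclicNode n (z - (n + 1)) = cyclicNode n z := fun z =>
      cyclicNode_eq_iff.2 ⟨-1, by ring⟩
    have h01 : (1 : Fin (n + 1)) ≠ 0 := by
      have := Fin.add_one_ne_self hn 0; rwa [zero_add] at this
    induction a using Int.induction_on with
    | zero => intro z; simp
    | succ a ih =>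
      intro z
      rw [zpow_add_one, affineAction_mul_apply, affineAction_simple_zero_mul_highestReflection, ih]
      by_cases hz1 : cyclicNode n z = 1
      · simp only [hz1, h01, e1, if_true, if_false]; ring
      by_cases hz0 : cyclicNode n z = 0
      · simp only [hz0, h01.symm, e2, if_true, if_false]; ring
      · simp only [hz1, hz0, if_false]
    | pred a ih =>
      intro z
      have hinv : affineAction hn cs (cs.simple 0 * highestReflection cs)⁻¹ z =
          if cyclicNode n z = 1 then z - (n + 1)
          else if cyclicNode n z = 0 then z + (n + 1) else z := by
        apply (affineAction hn cs (cs.simple 0 * highestReflection cs)).injective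
        rw [affineAction_apply_inv, affineAction_simple_zero_mul_highestReflection]
        by_cases hz1 : cyclicNode n z = 1
        · simp only [hz1, e2, if_true]; ring
        by_cases hz0 : cyclicNode n z = 0
        · simp only [hz0, h01.symm, e1, if_true, if_false]; ring
        · simp only [hz1, hz0, if_false]
      rw [zpow_sub_one, affineAction_mul_apply, hinv, ih]
      by_cases hz1 : cyclicNode n z = 1
      · simp only [hz1, e2, if_true]; ring
      by_cases hz0 : cyclicNode n z = 0
      · simp only [hz0, h01.symm, e1, if_true, if_false]; ring
      · simp only [hz1, hz0, if_false]
  obtain ⟨u, rfl⟩ : ∃ u, z = affineAction hn cs g u :=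
    ⟨_, (affineAction_apply_inv hn cs g z).symm⟩
  have hiff : ∀ u v, cyclicNode n (affineAction hn cs g u) = cyclicNode n (affineAction hn cs g v) ↔
      cyclicNode n u = cyclicNode n v := by
    intro u v
    simp only [cyclicNode_eq_iff, ← affineAction_add_mul, EmbeddingLike.apply_eq_iff_eq]
  rw [affineAction_mul_apply, affineAction_mul_apply, affineAction_inv_apply, hpow]
  simp only [hiff, h0, h1]
  split_ifs
  · rw [affineAction_add_mul]
  · rw [sub_eq_add_neg, ← mul_neg, affineAction_add_mul]; ring
  · rfl

theorem exists_affineAction_zero_one (r : ℕ) (hr : 1 ≤ r) (hrn : r ≤ n) :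
    ∃ g : W, affineAction hn cs g 0 = 0 ∧ affineAction hn cs g 1 = r := by
  induction r, hr using Nat.le_induction with
  | base => exact ⟨1, by simp⟩
  | succ r hr ih =>
    obtain ⟨g, h0, h1⟩ := ih (by omega)
    refine ⟨cs.simple (cyclicNode n r) * g, ?_, ?_⟩
    · rw [affineAction_mul_apply, h0, affineAction_simple]
      have hne : ∀ s : ℕ, 1 ≤ s → s ≤ n → cyclicNode n 0 ≠ cyclicNode n s := by
        intro s h1 h2 h
        have := cyclicNode_natCast_inj (Nat.zero_le n) h2 (by exact_mod_cast h)
        omega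
      refine affineSwap_apply_of_ne hn (hne r hr (by omega)) ?_
      rw [← cyclicNode_add_one]
      exact_mod_cast hne (r + 1) (by omega) hrn
    · rw [affineAction_mul_apply, h1, affineAction_simple, affineSwap_apply_left hn rfl]
      push_cast; rfl

/-- The elements of `W` that move every integer by a multiple of `m (n + 1)` lie in the normal
closure of `(s₀ t) ^ m`. -/
theorem mem_normalClosure_of_affineAction (m : ℕ) (w : W)
    (hw : ∀ z, ∃ a : ℤ, affineAction hn cs w z = z + (n + 1) * (m * a)) :
    w ∈ Subgroup.normalClosure {(cs.simple 0 * highestReflection cs) ^ m} := by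
  suffices H : ∀ d : ℕ, d ≤ n → ∀ w : W,
      (∀ z, ∃ a : ℤ, affineAction hn cs w z = z + (n + 1) * (m * a)) →
      (∀ r : ℕ, d < r → r ≤ n → affineAction hn cs w r = r) →
      w ∈ Subgroup.normalClosure {(cs.simple 0 * highestReflection cs) ^ m} from
    H n le_rfl w hw fun r h1 h2 => absurd h1 (not_lt.2 h2)
  intro d
  induction d with
  | zero =>
    intro _ w hw hfix
    -- Only class `0` can still move, and the vanishing total displacement rules that out.
    have hsum := affineAction_sum_displacement hn cs w
    rw [Fin.sum_univ_succ, Finset.sum_eq_zero, add_zero] at hsum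
    · have hall : ∀ r : Fin (n + 1), affineAction hn cs w ((r : ℕ) : ℤ) = ((r : ℕ) : ℤ) := by
        intro r
        rcases Nat.eq_zero_or_pos (r : ℕ) with hr | hr
        · rw [hr]; simpa [sub_eq_zero] using hsum
        · exact hfix r hr (Nat.lt_succ_iff.1 r.2)
      rw [eq_one_of_affineAction hn cs (w := w)]
      · exact one_mem _
      · intro z
        have h := cyclicNode_affineAction_congr hn cs w (cyclicNode_natCast_val (cyclicNode n z))
        rw [hall, sub_self] at h
        omega
    · intro r _
      rw [hfix _ (by simp) (by have := r.2; rw [Fin.val_succ]; omega), sub_self]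
  | succ d ih =>
    intro hd w hw hfix
    obtain ⟨g, hg0, hg1⟩ := exists_affineAction_zero_one hn cs (d + 1) (by omega) hd
    obtain ⟨a, ha⟩ := hw ((d + 1 : ℕ) : ℤ)
    -- This conjugate undoes the displacement of class `d + 1` at the expense of class `0`, leaving
    -- the classes already fixed untouched.
    set u : W := g * (cs.simple 0 * highestReflection cs) ^ ((m : ℤ) * -a) * g⁻¹ with hu
    have hmem : u ∈ Subgroup.normalClosure {(cs.simple 0 * highestReflection cs) ^ m} := by
      rw [hu, zpow_mul, zpow_natCast]
      exact Subgroup.normalClosure_normal.conj_mem _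
        (Subgroup.zpow_mem _ (Subgroup.subset_normalClosure (Set.mem_singleton _)) _) g
    have hact : ∀ z, affineAction hn cs u z =
        if cyclicNode n z = cyclicNode n ((d + 1 : ℕ) : ℤ) then z + (n + 1) * ((m : ℤ) * -a)
        else if cyclicNode n z = cyclicNode n ((0 : ℕ) : ℤ) then z - (n + 1) * ((m : ℤ) * -a)
        else z := by
      intro z
      have h := affineAction_conj_zpow hn cs g ((m : ℤ) * -a) z
      rw [hg0, hg1] at h
      exact h
    rw [← mul_mem_cancel_right hmem]
    refine ih (by omega) _ (fun z => ?_) fun r h1 h2 => ?_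
    · rw [affineAction_mul_apply]
      obtain ⟨b, hb⟩ := hw (affineAction hn cs u z)
      rw [hb, hact]
      split_ifs
      · exact ⟨b - a, by ring⟩
      · exact ⟨b + a, by ring⟩
      · exact ⟨b, rfl⟩
    · rw [affineAction_mul_apply, hact]
      split_ifs with h3 h4
      · obtain rfl := cyclicNode_natCast_inj h2 hd h3
        rw [affineAction_add_mul, ha]
        ring
      · have := cyclicNode_natCast_inj h2 (Nat.zero_le n) h4
        omega
      · refine hfix r (lt_of_le_of_ne h1 ?_) h2
        rintro rfl
        exact h3 rfl

end AffineTranslations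

/-! ### The kernel when `q² - 1` is regular. -/

theorem exoticCartanMatrix_transpose {k : Type*} [CommRing k] {n : ℕ} (hn : 1 ≤ n) (q q' : k) :
    (exoticCartanMatrix n q q').transpose = exoticCartanMatrix n q' q := by
  have h1 : ((1 : Fin (n + 1)) : ℕ) = 1 := by rw [Fin.val_one', Nat.mod_eq_of_lt (by omega)]
  ext i j
  have hi := i.2
  have hj := j.2
  simp only [Matrix.transpose_apply, exoticCartanMatrix, Matrix.of_apply, Fin.ext_iff, h1,
    Fin.val_last, Fin.val_zero]
  grind

theorem one_sub_sq_inv_mem_nonZeroDivisors {k : Type*} [CommRing k] {Q : kˣ}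
    (hQ : 1 - ((Q ^ 2 : kˣ) : k) ∈ nonZeroDivisors k) :
    1 - ((Q⁻¹ ^ 2 : kˣ) : k) ∈ nonZeroDivisors k := by
  have h : 1 - ((Q⁻¹ ^ 2 : kˣ) : k) =
      ((-(Q⁻¹ ^ 2) : kˣ) : k) * (1 - ((Q ^ 2 : kˣ) : k)) := by
    rw [mul_sub, mul_one, ← Units.val_mul, neg_mul, ← mul_pow, inv_mul_cancel, one_pow]
    simp; ring
  rw [h]
  exact mul_mem (Units.isUnit _).mem_nonZeroDivisors hQ

theorem eq_zero_of_nonZeroDivisor_smul {k h : Type*} [CommRing k] [AddCommGroup h] [Module k h]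
    [Module.Free k h] {a : k} (ha : a ∈ nonZeroDivisors k) {v : h} (hv : a • v = 0) : v = 0 := by
  let b := Module.Free.chooseBasis k h
  refine b.repr.injective (Finsupp.ext fun i => ?_)
  have h := congrArg (fun v => b.repr v i) hv
  simp only [map_smul, map_zero, Finsupp.smul_apply, smul_eq_mul, Finsupp.zero_apply] at h
  rw [map_zero, Finsupp.zero_apply]
  exact (mul_left_mem_nonZeroDivisors_eq_zero_iff ha).1 h

namespace Realization

/-- The dual realization, with simple coroots and simple roots exchanged. -/
def dual {B W : Type*} [Group W] {M : CoxeterMatrix B} {cs : CoxeterSystem M W} {k h : Type*}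
    [CommRing k] [AddCommGroup h] [Module k h] [Module.Free k h] [Module.Finite k h]
    (X : Realization cs k h) : Realization cs k (Module.Dual k h) where
  coroot := X.root
  root s := Module.Dual.eval k h (X.coroot s)
  root_coroot_self s := X.root_coroot_self s
  rep := X.rep.dual
  rep_simple s f := by
    ext v
    rw [Representation.dual_apply, cs.inv_simple, Module.Dual.transpose_apply,
      LinearMap.comp_apply, X.rep_simple, map_sub, map_smul]
    simp [mul_comm]

theorem rep_sub_mem_span {B W : Type*} [Group W] {M : CoxeterMatrix B} {cs : CoxeterSystem M W}
    {k h : Type*} [CommRing k] [AddCommGroup h] [Module k h] [Module.Free k h] [Module.Finite k h]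
    (X : Realization cs k h) (w : W) (v : h) :
    X.rep w v - v ∈ Submodule.span k (Set.range X.coroot) := by
  induction w using cs.simple_induction_left with
  | one => simp
  | mul_simple_left w i ih =>
    rw [map_mul, Module.End.mul_apply, X.rep_simple, sub_right_comm]
    exact sub_mem ih (Submodule.smul_mem _ _ (Submodule.subset_span ⟨i, rfl⟩))

theorem rep_eq_of_root_eq_zero {B W : Type*} [Group W] {M : CoxeterMatrix B}
    {cs : CoxeterSystem M W} {k h : Type*} [CommRing k] [AddCommGroup h] [Module k h]
    [Module.Free k h] [Module.Finite k h] (X : Realization cs k h) (w : W) {v : h}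
    (hv : ∀ s, X.root s v = 0) : X.rep w v = v := by
  induction w using cs.simple_induction_left with
  | one => simp
  | mul_simple_left w i ih =>
    rw [map_mul, Module.End.mul_apply, ih, X.rep_simple, hv, zero_smul, sub_zero]

section Exotic

variable {n : ℕ} {W : Type*} [Group W] {cs : CoxeterSystem (affineA n) W}
  {k : Type*} [CommRing k] {h : Type*} [AddCommGroup h] [Module k h] [Module.Free k h]
  [Module.Finite k h] (X : Realization cs k h) (Q : kˣ) (hn : 1 ≤ n)
  (hX : X.cartanMatrix = exoticCartanMatrix n (Q : k) (↑Q⁻¹ : k))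
include hn hX

theorem dual_cartanMatrix : X.dual.cartanMatrix = exoticCartanMatrix n (↑Q⁻¹ : k) (↑(Q⁻¹)⁻¹ : k) := by
  rw [inv_inv, ← exoticCartanMatrix_transpose hn, ← hX]
  rfl

/-- Triviality of `w` gives `ε_{w 0} = ε_0`; the functional first forces `w 0` into the class of
`0`, then compares the multipliers. -/
theorem affineAction_zero_of_rep_eq_one [Nontrivial k]
    (hQ : 1 - ((Q ^ 2 : kˣ) : k) ∈ nonZeroDivisors k) {w : W} (hw : X.rep w = 1) :
    ∃ a : ℤ, affineAction hn cs w 0 = (n + 1) * a ∧ (Q ^ 2) ^ a = 1 := by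
  have h1 := X.rep_exoticVector Q hn hX w 0
  have h0 : cyclicNode n 0 = 0 := cyclicNode_natCast_val (0 : Fin (n + 1))
  have hreg := mul_mem hQ (one_sub_sq_inv_mem_nonZeroDivisors hQ)
  rw [hw, Module.End.one_apply] at h1
  have h2 := congrArg (X.exoticFunctional Q) h1
  rw [exoticFunctional_exoticVector _ _ hn hX, exoticFunctional_exoticVector _ _ hn hX, if_pos h0,
    Int.zero_ediv, zpow_zero, Units.val_one, one_mul] at h2
  split_ifs at h2 with h3
  · refine ⟨affineAction hn cs w 0 / (n + 1), ?_, ?_⟩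
    · have := natCast_val_cyclicNode n (affineAction hn cs w 0)
      rw [h3, Fin.val_zero, Nat.cast_zero] at this
      linarith
    · ext
      rw [Units.val_one]
      rw [← sub_eq_zero]
      refine (mul_right_mem_nonZeroDivisors_eq_zero_iff hreg).1 ?_
      rw [sub_mul, one_mul, ← h2, sub_self]
  · exact absurd h2 (nonZeroDivisors.ne_zero hreg)

theorem affineAction_of_rep_eq_one [Nontrivial k]
    (hQ : 1 - ((Q ^ 2 : kˣ) : k) ∈ nonZeroDivisors k) {w : W} (hw : X.rep w = 1) (z : ℤ) :
    ∃ a : ℤ, affineAction hn cs w z = z + (n + 1) * a ∧ (Q ^ 2) ^ a = 1 := by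
  obtain ⟨g, rfl⟩ := exists_affineAction_eq hn cs 0 z
  have hw' : X.rep (g⁻¹ * w * g) = 1 := by
    rw [map_mul, map_mul, hw, mul_one, ← map_mul, inv_mul_cancel, map_one]
  obtain ⟨a, ha, hQa⟩ := X.affineAction_zero_of_rep_eq_one Q hn hX hQ hw'
  refine ⟨a, ?_, hQa⟩
  rw [← affineAction_add_mul, zero_add, ← ha, affineAction_mul_apply, affineAction_mul_apply,
    affineAction_apply_inv]

/-- After scaling by `1 - q²`, `v` is a combination of the `ε_r` with `0 ≤ r ≤ n`. It is
`W`-invariant, so each coefficient can be moved to class `0` and read off by the functional, which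
is built from roots and kills `v`. -/
theorem eq_zero_of_mem_span_coroot (hQ : 1 - ((Q ^ 2 : kˣ) : k) ∈ nonZeroDivisors k) {v : h}
    (hv : v ∈ Submodule.span k (Set.range X.coroot)) (hroot : ∀ i, X.root i v = 0) : v = 0 := by
  have hreg := mul_mem hQ (one_sub_sq_inv_mem_nonZeroDivisors hQ)
  have h0 : cyclicNode n 0 = 0 := cyclicNode_natCast_val (0 : Fin (n + 1))
  have hspan : (1 - ((Q ^ 2 : kˣ) : k)) • v ∈ Submodule.span k (Set.range (X.exoticBase Q)) := by
    have hε : ∀ z, X.exoticVector Q z ∈ Submodule.span k (Set.range (X.exoticBase Q)) := fun z =>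
      Submodule.smul_mem _ _ (Submodule.subset_span ⟨_, rfl⟩)
    clear hroot
    induction hv using Submodule.span_induction with
    | mem v hv =>
      obtain ⟨i, rfl⟩ := hv
      have h1 := congrArg (fun u => ((nodeScale Q i)⁻¹ : kˣ).val • u)
        (X.exoticBase_sub_exoticVector Q i)
      simp only [smul_smul] at h1
      rw [mul_left_comm, Units.inv_mul, mul_one] at h1
      rw [← h1]
      exact Submodule.smul_mem _ _ (sub_mem (Submodule.subset_span ⟨_, rfl⟩) (hε _))
    | zero => simp
    | add u v _ _ hu hv =>
      rw [smul_add]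
      exact add_mem hu hv
    | smul a v _ hv =>
      rw [smul_comm]
      exact Submodule.smul_mem _ _ hv
  obtain ⟨d, hd⟩ := (Submodule.mem_span_range_iff_exists_fun k).1 hspan
  refine eq_zero_of_nonZeroDivisor_smul hQ ?_
  rw [← hd]
  refine Finset.sum_eq_zero fun s _ => ?_
  obtain ⟨g, hg⟩ := exists_affineAction_eq hn cs ((s : ℕ) : ℤ) 0
  have h1 : X.exoticFunctional Q (X.rep g ((1 - ((Q ^ 2 : kˣ) : k)) • v)) = 0 := by
    rw [map_smul, X.rep_eq_of_root_eq_zero g hroot, map_smul, exoticFunctional]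
    simp [hroot]
  -- Among `0, …, n` only `s` is sent by `g` into the class of `0`.
  rw [← hd, map_sum, map_sum, Finset.sum_eq_single s] at h1
  · rw [map_smul, map_smul, ← exoticVector_natCast, X.rep_exoticVector Q hn hX, hg,
      exoticFunctional_exoticVector _ _ hn hX, if_pos h0, Int.zero_ediv, zpow_zero, Units.val_one,
      one_mul, smul_eq_mul, mul_right_mem_nonZeroDivisors_eq_zero_iff hreg] at h1
    rw [h1, zero_smul]
  · intro r _ hr
    rw [map_smul, map_smul, ← exoticVector_natCast, X.rep_exoticVector Q hn hX,
      exoticFunctional_exoticVector _ _ hn hX, if_neg, smul_zero]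
    intro h2
    rw [← h0, ← hg, cyclicNode_eq_iff] at h2
    obtain ⟨a, ha⟩ := h2
    rw [← affineAction_add_mul, EmbeddingLike.apply_eq_iff_eq] at ha
    have := cyclicNode_eq_iff.2 ⟨a, ha⟩
    rw [cyclicNode_natCast_val, cyclicNode_natCast_val] at this
    exact hr this
  · simp

theorem rep_coroot_of_affineAction (hQ : 1 - ((Q ^ 2 : kˣ) : k) ∈ nonZeroDivisors k) {w : W}
    (hw : ∀ z, ∃ a : ℤ, affineAction hn cs w z = z + (n + 1) * a ∧ (Q ^ 2) ^ a = 1)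
    (i : Fin (n + 1)) : X.rep w (X.coroot i) = X.coroot i := by
  have hε : ∀ z, X.rep w (X.exoticVector Q z) = X.exoticVector Q z := by
    intro z
    obtain ⟨a, ha, hQa⟩ := hw z
    rw [X.rep_exoticVector Q hn hX, ha, exoticVector_add_mul, hQa, Units.val_one, one_smul]
  have h1 := X.exoticBase_sub_exoticVector Q i
  have h2 := congrArg (X.rep w) h1
  rw [map_sub, ← exoticVector_natCast, hε, hε, exoticVector_natCast, h1, map_smul, eq_comm,
    ← sub_eq_zero, ← smul_sub] at h2
  exact sub_eq_zero.1 (eq_zero_of_nonZeroDivisor_smul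
    (mul_mem hQ (Units.isUnit _).mem_nonZeroDivisors) h2)

/-- Fixing the coroots is not enough, since they need not span. The dual realization, with `q`
inverted, shows that the roots are fixed too, so they kill `w v - v`. -/
theorem rep_eq_one_of_affineAction (hQ : 1 - ((Q ^ 2 : kˣ) : k) ∈ nonZeroDivisors k) {w : W}
    (hw : ∀ z, ∃ a : ℤ, affineAction hn cs w z = z + (n + 1) * a ∧ (Q ^ 2) ^ a = 1) :
    X.rep w = 1 := by
  ext v
  rw [Module.End.one_apply, ← sub_eq_zero]
  refine X.eq_zero_of_mem_span_coroot Q hn hX hQ (X.rep_sub_mem_span w v) fun i => ?_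
  have h1 := X.dual.rep_coroot_of_affineAction Q⁻¹ hn (X.dual_cartanMatrix Q hn hX)
    (one_sub_sq_inv_mem_nonZeroDivisors hQ) (w := w) (fun z => by
      obtain ⟨a, ha, hQa⟩ := hw z
      exact ⟨a, ha, by rw [inv_pow, inv_zpow, hQa, inv_one]⟩) i
  have h2 : X.root i (X.rep w⁻¹ (X.rep w v)) = X.root i (X.rep w v) :=
    LinearMap.congr_fun h1 (X.rep w v)
  rw [← Module.End.mul_apply, ← map_mul, inv_mul_cancel, map_one, Module.End.one_apply] at h2
  rw [map_sub, h2, sub_self]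

theorem rep_eq_one_iff [Nontrivial k] (hQ : 1 - ((Q ^ 2 : kˣ) : k) ∈ nonZeroDivisors k) (w : W) :
    X.rep w = 1 ↔
      ∀ z, ∃ a : ℤ, affineAction hn cs w z = z + (n + 1) * a ∧ (Q ^ 2) ^ a = 1 :=
  ⟨fun h => X.affineAction_of_rep_eq_one Q hn hX hQ h,
    X.rep_eq_one_of_affineAction Q hn hX hQ⟩

theorem ker_rep_eq_normalClosure [Nontrivial k]
    (hQ : 1 - ((Q ^ 2 : kˣ) : k) ∈ nonZeroDivisors k) {m : ℕ} (hm : IsPrimitiveRoot (Q ^ 2) m) :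
    MonoidHom.ker X.rep =
      Subgroup.normalClosure {(cs.simple 0 * highestReflection cs) ^ m} := by
  apply le_antisymm
  · intro w hw
    refine mem_normalClosure_of_affineAction hn cs m w fun z => ?_
    obtain ⟨a, ha, hQa⟩ := (X.rep_eq_one_iff Q hn hX hQ w).1 hw z
    obtain ⟨b, rfl⟩ := (hm.zpow_eq_one_iff_dvd a).1 hQa
    exact ⟨b, ha⟩
  · refine Subgroup.normalClosure_le_normal (Set.singleton_subset_iff.2 ?_)
    refine (X.rep_eq_one_iff Q hn hX hQ _).2 fun z => ?_
    have h := affineAction_conj_zpow hn cs 1 m z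
    rw [one_mul, inv_one, mul_one, zpow_natCast] at h
    rw [h]
    split_ifs
    · exact ⟨m, rfl, by rw [zpow_natCast, hm.pow_eq_one]⟩
    · exact ⟨-m, by ring, by rw [zpow_neg, zpow_natCast, hm.pow_eq_one, inv_one]⟩
    · exact ⟨0, by ring, zpow_zero _⟩

theorem not_injective_rep [Nontrivial k]
    (hQ : 1 - ((Q ^ 2 : kˣ) : k) ∈ nonZeroDivisors k) {m : ℕ} (h0m : 0 < m)
    (hm : IsPrimitiveRoot (Q ^ 2) m) : ¬ Function.Injective X.rep := by
  intro hinj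
  have h1 : (cs.simple 0 * highestReflection cs) ^ m ∈ MonoidHom.ker X.rep := by
    rw [X.ker_rep_eq_normalClosure Q hn hX hQ hm]
    exact Subgroup.subset_normalClosure rfl
  have h2 : (cs.simple 0 * highestReflection cs) ^ m = 1 := hinj (h1.trans (map_one _).symm)
  have h3 := affineAction_conj_zpow hn cs 1 m 1
  rw [zpow_natCast, h2] at h3
  simp only [mul_one, inv_one, map_one, Equiv.Perm.one_apply, if_true, left_eq_add] at h3
  have : (0 : ℤ) < (n + 1) * m := by positivity
  omega

end Exotic

end Realization

/-! ### Torsion and nilpotence estimates for the case where `q²` is not a root of unity. -/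

/-- Dividing `f` and `a` by their gcd leaves a cofactor of `f` whose square divides `b`; it is a
unit. -/
theorem dvd_of_sq_dvd_sq_mul_of_squarefree {α : Type*} [CommMonoidWithZero α] [GCDMonoid α]
    {f a b : α} (h : f ^ 2 ∣ a ^ 2 * b) (hb : Squarefree b) : f ∣ a := by
  obtain ⟨f', a', hf, ha, hu⟩ := extract_gcd f a
  generalize gcd f a = d at hf ha
  subst hf ha
  rcases eq_or_ne d 0 with rfl | h0
  · rw [zero_mul, zero_mul]
  rw [gcd_isUnit_iff_isRelPrime] at hu
  rw [mul_pow, mul_pow, mul_assoc] at h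
  have h1 : f' ^ 2 ∣ b :=
    hu.pow.dvd_of_dvd_mul_left ((mul_dvd_mul_iff_left (pow_ne_zero 2 h0)).1 h)
  have h2 : IsUnit f' := hb f' (by rwa [← pow_two])
  exact mul_dvd_mul_left _ h2.dvd

open Polynomial in
theorem squarefree_X_sq_sub_one : Squarefree (X ^ 2 - 1 : ℚ[X]) := by
  have h := separable_X_pow_sub_C (n := 2) (1 : ℚ) (by norm_num) one_ne_zero
  rw [C_1] at h
  exact h.squarefree

theorem exists_nat_mul_eq_zero_of_one_tmul_eq_zero {k : Type*} [CommRing k] {a : k}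
    (ha : (1 : ℚ) ⊗ₜ[ℤ] a = 0) : ∃ M : ℕ, 0 < M ∧ (M : k) * a = 0 := by
  have h := (IsLocalizedModule.eq_zero_iff (nonZeroDivisors ℤ) (TensorProduct.mk ℤ ℚ k 1)
    (m := a)).1 ha
  obtain ⟨⟨c, hc⟩, h⟩ := h
  have hc0 : c ≠ 0 := nonZeroDivisors.ne_zero hc
  have h' : (c : k) * a = 0 := by
    rw [← zsmul_eq_mul]; exact h
  obtain ⟨M, rfl | rfl⟩ := c.eq_nat_or_neg
  · exact ⟨M, by omega, by exact_mod_cast h'⟩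
  · refine ⟨M, by omega, ?_⟩
    push_cast at h'
    rwa [neg_mul, neg_eq_zero] at h'

open Polynomial in
/-- If `(q²ˡ - 1)² (q² - 1)` lies in the square of the kernel of `ℤ[q, q⁻¹] → k`, then `q²ˡ - 1` is
a torsion element of `k`. -/
theorem exists_nat_mul_sub_one_eq_zero {k : Type*} [CommRing k] [Algebra ℤ[T;T⁻¹] k] (l : ℕ)
    (h : ((LaurentPolynomial.T 1 ^ 2) ^ l - 1) ^ 2 * (LaurentPolynomial.T 1 ^ 2 - 1) ∈
      RingHom.ker (algebraMap ℤ[T;T⁻¹] k) ^ 2) :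
    ∃ M : ℕ, 0 < M ∧
      (M : k) * ((algebraMap ℤ[T;T⁻¹] k (LaurentPolynomial.T 1) ^ 2) ^ l - 1) = 0 := by
  set K := RingHom.ker (algebraMap ℤ[T;T⁻¹] k)
  set q := algebraMap ℤ[T;T⁻¹] k (LaurentPolynomial.T 1)
  have hqu : IsUnit q := (LaurentPolynomial.isUnit_T 1).map _
  let ψ : ℚ[X] →ₐ[ℚ] (ℚ ⊗[ℤ] k) := aeval ((1 : ℚ) ⊗ₜ[ℤ] q)
  have hψ : ∀ p : ℤ[X], ψ (p.map (Int.castRingHom ℚ)) =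
      (1 : ℚ) ⊗ₜ[ℤ] algebraMap ℤ[T;T⁻¹] k (algebraMap ℤ[X] ℤ[T;T⁻¹] p) := by
    intro p
    have : (ψ : ℚ[X] →+* ℚ ⊗[ℤ] k).comp (mapRingHom (Int.castRingHom ℚ)) =
        ((Algebra.TensorProduct.includeRight : k →ₐ[ℤ] ℚ ⊗[ℤ] k) : k →+* ℚ ⊗[ℤ] k).comp
          ((algebraMap ℤ[T;T⁻¹] k).comp (algebraMap ℤ[X] ℤ[T;T⁻¹])) := by
      apply Polynomial.ringHom_ext
      · intro a; simp
      · simp [ψ, q]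
    exact RingHom.congr_fun this p
  -- `ℤ[q, q⁻¹]` is a localization of `ℤ[X]`, so membership in `K²` becomes membership in the square
  -- of the contracted ideal after multiplying by some `X ^ s`.
  have hK : (K.comap (algebraMap ℤ[X] ℤ[T;T⁻¹])).map (algebraMap ℤ[X] ℤ[T;T⁻¹]) = K :=
    IsLocalization.map_under (Submonoid.powers (X : ℤ[X])) _ K
  rw [← hK, ← Ideal.map_pow, IsLocalization.mem_map_algebraMap_iff (Submonoid.powers (X : ℤ[X]))]
    at h
  obtain ⟨⟨⟨p, hp⟩, ⟨_, s, rfl⟩⟩, hps⟩ := h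
  have hp' : p = ((X ^ 2) ^ l - 1) ^ 2 * (X ^ 2 - 1) * X ^ s := by
    apply Polynomial.toLaurent_injective
    rw [← LaurentPolynomial.algebraMap_eq_toLaurent, ← hps]
    simp
  have hle : (K.comap (algebraMap ℤ[X] ℤ[T;T⁻¹])).map (mapRingHom (Int.castRingHom ℚ)) ≤
      RingHom.ker ψ := by
    rw [Ideal.map_le_iff_le_comap]
    intro p hp
    have hp : algebraMap ℤ[T;T⁻¹] k (algebraMap ℤ[X] ℤ[T;T⁻¹] p) = 0 := hp
    change ψ (p.map (Int.castRingHom ℚ)) = 0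
    rw [hψ, hp, TensorProduct.tmul_zero]
  have hp2 := Ideal.pow_right_mono hle 2
    (by rw [← Ideal.map_pow]; exact Ideal.mem_map_of_mem (mapRingHom (Int.castRingHom ℚ)) hp)
  obtain ⟨f, hf⟩ := (IsPrincipalIdealRing.principal (RingHom.ker ψ)).principal
  change RingHom.ker ψ = Ideal.span {f} at hf
  rw [hf, Ideal.span_singleton_pow, Ideal.mem_span_singleton, hp'] at hp2
  have hdvd : f ∣ ((X ^ 2) ^ l - 1) * X ^ s := by
    let := IsBezout.toGCDDomain ℚ[X]
    -- A second factor `X ^ s` completes the square; it is harmless because `q` is invertible in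
    -- `k`.
    refine dvd_of_sq_dvd_sq_mul_of_squarefree (b := X ^ 2 - 1) (hp2.trans ?_) squarefree_X_sq_sub_one
    simp only [coe_mapRingHom, Polynomial.map_mul, Polynomial.map_pow, Polynomial.map_sub, map_X,
      Polynomial.map_one]
    exact ⟨X ^ s, by ring⟩
  have hker : ψ (((X ^ 2) ^ l - 1) * X ^ s) = 0 := by
    rw [← RingHom.mem_ker, hf, Ideal.mem_span_singleton]
    exact hdvd
  have hval : ψ (((X ^ 2) ^ l - 1) * X ^ s) = (1 : ℚ) ⊗ₜ[ℤ] (((q ^ 2) ^ l - 1) * q ^ s) := by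
    have := hψ (((X ^ 2) ^ l - 1) * X ^ s)
    simpa only [Polynomial.map_mul, Polynomial.map_sub, Polynomial.map_pow, map_X,
      Polynomial.map_one, map_mul, map_sub, map_pow, map_one, LaurentPolynomial.algebraMap_eq_toLaurent,
      toLaurent_X] using this
  rw [hval] at hker
  obtain ⟨M, hM, h0⟩ := exists_nat_mul_eq_zero_of_one_tmul_eq_zero hker
  refine ⟨M, hM, (hqu.pow s).mul_left_eq_zero.1 ?_⟩
  rw [mul_assoc]
  exact h0

theorem one_add_pow_of_sq_eq_zero {k : Type*} [CommRing k] {z : k} (hz : z ^ 2 = 0) (M : ℕ) :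
    (1 + z) ^ M = 1 + M * z := by
  induction M with
  | zero => simp
  | succ M ih =>
    rw [pow_succ, ih]
    push_cast
    linear_combination (M : k) * hz

theorem mem_ker_smul_top_of_one_tmul_eq_zero {R k h : Type*} [CommRing R] [CommRing k]
    [Algebra R k] [AddCommGroup h] [Module R h] [Module.Free R h] {v : h}
    (hv : (1 : k) ⊗ₜ[R] v = 0) : v ∈ RingHom.ker (algebraMap R k) • (⊤ : Submodule R h) := by
  let b := Module.Free.chooseBasis R h
  rw [← b.linearCombination_repr v, Finsupp.linearCombination_apply]
  refine Submodule.sum_mem _ fun i _ => Submodule.smul_mem_smul ?_ trivial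
  have h1 := congrArg (fun u => (b.baseChange k).repr u i) hv
  simp only [Module.Basis.baseChange_repr_tmul, map_zero, Finsupp.zero_apply] at h1
  rw [RingHom.mem_ker, Algebra.algebraMap_eq_smul_one]
  exact h1

/-- If `w` acts trivially on the base change to `k`, then `w - 1` has its entries in the kernel `K`
of `R → k`; so an eigenvalue of `w` is congruent to `1` modulo `K`, up to the value of a root on
the eigenvector, and the square of the difference lies in `K²` with the same proviso. -/
theorem Realization.sub_one_mul_root_mem_ker {B W : Type*} [Group W] {M : CoxeterMatrix B}
    {cs : CoxeterSystem M W} {R h : Type*} [CommRing R] [AddCommGroup h] [Module R h]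
    [Module.Free R h] [Module.Finite R h] (X : Realization cs R h) (k : Type*) [CommRing k]
    [Algebra R k] {w : W} (hw : (X.baseChange k).rep w = 1) {v : h} {a : R}
    (hv : X.rep w v = a • v) (s : B) :
    (a - 1) * X.root s v ∈ RingHom.ker (algebraMap R k) ∧
      (a - 1) ^ 2 * X.root s v ∈ RingHom.ker (algebraMap R k) ^ 2 := by
  set K := RingHom.ker (algebraMap R k)
  have hD : ∀ v, (X.rep w - 1) v ∈ K • (⊤ : Submodule R h) := by
    intro v
    apply mem_ker_smul_top_of_one_tmul_eq_zero
    have h1 : (1 : k) ⊗ₜ[R] X.rep w v = 1 ⊗ₜ v :=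
      (LinearMap.baseChange_tmul (X.rep w) 1 v).symm.trans (LinearMap.congr_fun hw _)
    rw [LinearMap.sub_apply, Module.End.one_apply, TensorProduct.tmul_sub, h1, sub_self]
  -- By linearity `w - 1` maps `K h` into `K (w - 1) h`, which lies in `K² h`.
  have hD2 : ∀ v, (X.rep w - 1) ((X.rep w - 1) v) ∈ K ^ 2 • (⊤ : Submodule R h) := by
    intro v
    have h1 := Submodule.mem_map_of_mem (f := X.rep w - 1) (hD v)
    rw [Submodule.map_smul''] at h1
    rw [pow_two, Submodule.mul_smul]
    refine Submodule.smul_mono le_rfl ?_ h1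
    rw [Submodule.map_le_iff_le_comap]
    exact fun v _ => hD v
  have hα : ∀ I : Ideal R, ∀ v ∈ I • (⊤ : Submodule R h), X.root s v ∈ I := by
    intro I v hv
    refine Submodule.smul_induction_on hv (fun r hr u _ => ?_) fun u u' hu hu' => ?_
    · rw [map_smul, smul_eq_mul]
      exact I.mul_mem_right _ hr
    · rw [map_add]
      exact I.add_mem hu hu'
  have hE : (X.rep w - 1) v = (a - 1) • v := by
    rw [LinearMap.sub_apply, hv, Module.End.one_apply, sub_smul, one_smul]
  constructor
  · have h1 := hα _ _ (hD v)
    rwa [hE, map_smul, smul_eq_mul] at h1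
  · have h1 := hα _ _ (hD2 v)
    rw [hE, map_smul, hE, map_smul, map_smul, smul_eq_mul, smul_eq_mul, ← mul_assoc] at h1
    rwa [pow_two (a - 1)]

/-- The eigenvector is `ε_0`, and the root of node `0` takes on it the value `q² - 1` up to a unit.
Torsion and square-zero together make `q^{2l}` a root of unity. -/
theorem exists_pos_pow_eq_one_of_baseChange_rep_eq_one {n : ℕ} (hn : 1 ≤ n) {W : Type*} [Group W]
    {cs : CoxeterSystem (affineA n) W} {h : Type*} [AddCommGroup h] [Module ℤ[T;T⁻¹] h]
    [Module.Free ℤ[T;T⁻¹] h] [Module.Finite ℤ[T;T⁻¹] h] (X : Realization cs ℤ[T;T⁻¹] h)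
    (Q : ℤ[T;T⁻¹]ˣ) (hQ : (Q : ℤ[T;T⁻¹]) = LaurentPolynomial.T 1)
    (hX : X.cartanMatrix = exoticCartanMatrix n (Q : ℤ[T;T⁻¹]) (↑Q⁻¹ : ℤ[T;T⁻¹]))
    (k : Type*) [CommRing k] [Algebra ℤ[T;T⁻¹] k] {w : W} (hw : (X.baseChange k).rep w = 1) {l : ℕ}
    (hl : affineAction hn cs w 0 = (n + 1) * l) :
    ∃ M : ℕ, 0 < M ∧ (algebraMap ℤ[T;T⁻¹] k (LaurentPolynomial.T 1) ^ 2) ^ (l * M) = 1 := by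
  have hE : X.rep w (X.exoticVector Q 0) =
      (((LaurentPolynomial.T 1 : ℤ[T;T⁻¹]) ^ 2) ^ l) • X.exoticVector Q 0 := by
    have h2 := X.exoticVector_add_mul Q 0 l
    rw [zero_add] at h2
    rw [X.rep_exoticVector Q hn hX, hl, h2, zpow_natCast, Units.val_pow_eq_pow_val,
      Units.val_pow_eq_pow_val, hQ]
  have hr : X.root 0 (X.exoticVector Q 0) =
      ((-nodeScale Q (0 : Fin (n + 1)) : ℤ[T;T⁻¹]ˣ) : ℤ[T;T⁻¹]) *
        ((LaurentPolynomial.T 1 : ℤ[T;T⁻¹]) ^ 2 - 1) := by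
    have h2 := X.exoticVector_natCast Q 0
    rw [Fin.val_zero, Nat.cast_zero] at h2
    rw [h2, X.root_exoticBase Q hn hX, if_pos rfl, Units.val_pow_eq_pow_val, hQ, Units.val_neg]
    ring
  obtain ⟨h1, h2⟩ := X.sub_one_mul_root_mem_ker k hw hE 0
  rw [hr, mul_left_comm, Ideal.unit_mul_mem_iff_mem _ (Units.isUnit _)] at h1 h2
  obtain ⟨M, hM, h3⟩ := exists_nat_mul_sub_one_eq_zero l h2
  rw [RingHom.mem_ker, map_mul, map_sub, map_sub, map_pow, map_pow, map_one] at h1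
  generalize algebraMap ℤ[T;T⁻¹] k (LaurentPolynomial.T 1) = q at *
  -- One factor `q^{2l} - 1` is a multiple of `q² - 1`, which the other factor annihilates.
  have h4 : ((q ^ 2) ^ l - 1) ^ 2 = 0 := by
    obtain ⟨c, hc⟩ := sub_one_dvd_pow_sub_one (q ^ 2) l
    rw [pow_two]
    nth_rewrite 2 [hc]
    rw [← mul_assoc, h1, zero_mul]
  refine ⟨M, hM, ?_⟩
  rw [pow_mul]
  have h5 := one_add_pow_of_sq_eq_zero h4 M
  rwa [h3, add_sub_cancel, add_zero] at h5

/-! ### Base change of the Cartan matrix and the theorem. -/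

theorem baseChange_cartanMatrix {B W : Type*} [Group W] {M : CoxeterMatrix B}
    {cs : CoxeterSystem M W} {R h : Type*} [CommRing R] [AddCommGroup h]
    [Module R h] [Module.Free R h] [Module.Finite R h] (X : Realization cs R h)
    (k : Type*) [CommRing k] [Algebra R k] :
    (X.baseChange k).cartanMatrix = X.cartanMatrix.map (algebraMap R k) := by
  ext s t
  change (X.root t).baseChange k (1 ⊗ₜ X.coroot s) = algebraMap R k (X.root t (X.coroot s))
  rw [Module.Dual.baseChange_apply_tmul, Algebra.algebraMap_eq_smul_one]

theorem exoticCartanMatrix_map {R k : Type*} [CommRing R] [CommRing k] (f : R →+* k) (n : ℕ)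
    (q q' : R) :
    (exoticCartanMatrix n q q').map f = exoticCartanMatrix n (f q) (f q') := by
  ext i j
  simp only [Matrix.map_apply, exoticCartanMatrix, Matrix.of_apply]
  simp only [apply_ite f, map_neg, map_add, map_one, map_zero, map_ofNat]

theorem mainTheorem2 (n : ℕ) (hn : 1 ≤ n) {W : Type*} [Group W]
    (cs : CoxeterSystem (affineA n) W)
    {h : Type*} [AddCommGroup h] [Module ℤ[T;T⁻¹] h] [Module.Free ℤ[T;T⁻¹] h]
    [Module.Finite ℤ[T;T⁻¹] h]
    (X : Realization cs ℤ[T;T⁻¹] h) (hX : X.IsExotic)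
    (k : Type*) [CommRing k] [Nontrivial k] (h2 : ∀ a : k, 2 * a = 0 → a = 0)
    [Algebra ℤ[T;T⁻¹] k]
    (q : k) (hq : q = algebraMap ℤ[T;T⁻¹] k (LaurentPolynomial.T 1)) :
    ((¬ ∃ m : ℕ, 0 < m ∧ (q ^ 2) ^ m = 1) → Function.Injective (X.baseChange k).rep) ∧
    (∀ m : ℕ, 0 < m → IsPrimitiveRoot (q ^ 2) m → q ^ 2 - 1 ∈ nonZeroDivisors k →
      ¬ Function.Injective (X.baseChange k).rep ∧
      MonoidHom.ker (X.baseChange k).rep =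
        Subgroup.normalClosure {(cs.simple 0 * highestReflection cs) ^ m}) := by
  let Q : ℤ[T;T⁻¹]ˣ := ⟨LaurentPolynomial.T 1, LaurentPolynomial.T (-1),
    by rw [← LaurentPolynomial.T_add, add_neg_cancel, LaurentPolynomial.T_zero],
    by rw [← LaurentPolynomial.T_add, neg_add_cancel, LaurentPolynomial.T_zero]⟩
  have hXQ : X.cartanMatrix = exoticCartanMatrix n (Q : ℤ[T;T⁻¹]) (↑Q⁻¹ : ℤ[T;T⁻¹]) := hX
  constructor
  · intro hroot
    have hnat : ∀ w, (X.baseChange k).rep w = 1 → ∀ l : ℕ, affineAction hn cs w 0 = (n + 1) * l →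
        l = 0 := by
      intro w hw l hl
      obtain ⟨M, hM, h1⟩ :=
        exists_pos_pow_eq_one_of_baseChange_rep_eq_one hn X Q rfl hXQ k hw hl
      rw [← hq] at h1
      by_contra hl0
      exact hroot ⟨l * M, Nat.mul_pos (Nat.pos_of_ne_zero hl0) hM, h1⟩
    have hinv : ∀ w, (X.baseChange k).rep w = 1 → (X.baseChange k).rep w⁻¹ = 1 := fun w hw =>
      inv_mem (show w ∈ MonoidHom.ker (X.baseChange k).rep from hw)
    have hint : ∀ w, (X.baseChange k).rep w = 1 → ∀ l : ℤ, affineAction hn cs w 0 = (n + 1) * l →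
        l = 0 := by
      intro w hw l hl
      obtain ⟨a, rfl | rfl⟩ := l.eq_nat_or_neg
      · exact_mod_cast hnat w hw a hl
      · have hw' := hinv w hw
        have h1 := affineAction_inv_apply hn cs w 0
        rw [hl, ← zero_add (((n : ℤ) + 1) * -(a : ℤ)), affineAction_add_mul] at h1
        rw [hnat w⁻¹ hw' a (by linarith)]
        simp
    have hconj : ∀ g w, (X.baseChange k).rep w = 1 → (X.baseChange k).rep (g⁻¹ * w * g) = 1 := by
      intro g w hw
      rw [map_mul, map_mul, hw, mul_one, ← map_mul, inv_mul_cancel, map_one]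
    -- A kernel element preserving all classes is trivial: conjugating by `g` turns its displacement
    -- at any integer into the displacement at `0`.
    have htrans : ∀ w, (X.baseChange k).rep w = 1 →
        (∀ z, cyclicNode n (affineAction hn cs w z) = cyclicNode n z) → w = 1 := by
      intro w hw hz
      refine eq_one_of_affineAction hn cs fun z => ?_
      obtain ⟨g, rfl⟩ := exists_affineAction_eq hn cs 0 z
      obtain ⟨a, ha⟩ := cyclicNode_eq_iff.1 (hz (affineAction hn cs g 0))
      have h1 := hint _ (hconj g w hw) a (by
        rw [affineAction_mul_apply, affineAction_mul_apply, ha, ← affineAction_add_mul,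
          affineAction_inv_apply, zero_add])
      rw [ha, h1, mul_zero, add_zero]
    obtain ⟨τ, hτ⟩ : ∃ τ : W, ∀ z, affineAction hn cs τ z =
        if cyclicNode n z = 1 then z + (n + 1)
        else if cyclicNode n z = 0 then z - (n + 1) else z :=
      ⟨_, affineAction_simple_zero_mul_highestReflection hn cs⟩
    have hτc : ∀ z, cyclicNode n (affineAction hn cs τ z) = cyclicNode n z := by
      intro z
      rw [hτ, cyclicNode_eq_iff]
      split_ifs
      · exact ⟨1, by ring⟩
      · exact ⟨-1, by ring⟩
      · exact ⟨0, by ring⟩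
    have hc1 : cyclicNode n 1 = 1 := by
      rw [← zero_add (1 : ℤ), cyclicNode_add_one,
        show cyclicNode n 0 = 0 from cyclicNode_natCast_val (0 : Fin (n + 1)), zero_add]
    -- The commutator with `τ` preserves classes and lies in the kernel, so it is trivial. Since
    -- class `1` is the only one that `τ` moves up by a period, `w` must send `1` into it.
    have hone : ∀ w, (X.baseChange k).rep w = 1 →
        cyclicNode n (affineAction hn cs w 1) = 1 := by
      intro w hw
      have hcomm : w * τ * w⁻¹ * τ⁻¹ = 1 := by
        refine htrans _ ?_ fun z => ?_
        · have h1 : (X.baseChange k).rep (τ * w⁻¹ * τ⁻¹) = 1 := by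
            have := hconj τ⁻¹ w⁻¹ (hinv w hw)
            rwa [inv_inv] at this
          rw [mul_assoc, mul_assoc, ← mul_assoc τ, map_mul, hw, h1, mul_one]
        · have h1 : z = affineAction hn cs τ (affineAction hn cs w
              (affineAction hn cs w⁻¹ (affineAction hn cs τ⁻¹ z))) := by
            rw [affineAction_apply_inv, affineAction_apply_inv]
          conv_rhs => rw [h1, hτc]
          simp only [affineAction_mul_apply]
          obtain ⟨a, ha⟩ := cyclicNode_eq_iff.1
            (hτc (affineAction hn cs w⁻¹ (affineAction hn cs τ⁻¹ z)))
          rw [ha, affineAction_add_mul, cyclicNode_add_mul]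
      have h1 : affineAction hn cs (w * τ) 1 = affineAction hn cs (τ * w) 1 := by
        rw [mul_inv_eq_one, mul_inv_eq_iff_eq_mul] at hcomm
        rw [hcomm]
      have h3 := affineAction_add_mul hn cs w 1 1
      rw [mul_one] at h3
      rw [affineAction_mul_apply, affineAction_mul_apply, hτ, hτ, if_pos hc1, h3] at h1
      split_ifs at h1 with h4 h5
      · exact h4
      · omega
      · omega
    rw [injective_iff_map_eq_one]
    intro w hw
    -- Conjugation carries the conclusion for class `1` to the class of any `z`.
    refine htrans w hw fun z => ?_
    obtain ⟨g, rfl⟩ := exists_affineAction_eq hn cs 1 z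
    have h1 := hone _ (hconj g w hw)
    rw [← hc1, cyclicNode_eq_iff] at h1
    obtain ⟨a, ha⟩ := h1
    rw [affineAction_mul_apply, affineAction_mul_apply] at ha
    have h3 := congrArg (affineAction hn cs g) ha
    rw [affineAction_apply_inv, affineAction_add_mul] at h3
    rw [h3, cyclicNode_add_mul]
  · intro m hm hprim hreg
    let Qk : kˣ := Units.map (algebraMap ℤ[T;T⁻¹] k : ℤ[T;T⁻¹] →* k) Q
    have hQk : ((Qk ^ 2 : kˣ) : k) = q ^ 2 := by
      rw [hq]; rfl
    have hXk : (X.baseChange k).cartanMatrix = exoticCartanMatrix n (Qk : k) (↑Qk⁻¹ : k) := by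
      rw [baseChange_cartanMatrix, hXQ, exoticCartanMatrix_map]
      rfl
    have hQreg : 1 - ((Qk ^ 2 : kˣ) : k) ∈ nonZeroDivisors k := by
      rw [hQk, ← neg_sub, ← neg_one_mul]
      exact mul_mem isUnit_one.neg.mem_nonZeroDivisors hreg
    have hprim' : IsPrimitiveRoot (Qk ^ 2) m := by
      rw [← IsPrimitiveRoot.coe_units_iff, hQk]
      exact hprim
    exact ⟨(X.baseChange k).not_injective_rep Qk hn hXk hQreg hm hprim',
      (X.baseChange k).ker_rep_eq_normalClosure Qk hn hXk hQreg hprim'⟩
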